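/- Fix integers $T\ge 2$ and $K\ge 0$. For units $i=1,2,\dots$ and $t=1,\dots,T$ let $$y_{i,t}=\rho y_{i,t-1}+x_{i,t}'\beta+\alpha_i+\varepsilon_{i,t},\qquad \beta=(1-\rho)\check\beta,\quad \alpha_i=(1-\rho)\mu_i,$$ with $-1\le\rho\le 1$. Let $\varepsilon_i=(\varepsilon_{i,1},\dots,\varepsilon_{i,T})'$, let $X_i$ be the $T\times K$ matrix with rows $x_{i,t}'$, and put $y_i=(y_{i,1},\dots,y_{i,T})'$, $y_{i,-1}=(y_{i,0},\dots,y_{i,T-1})'$, $Q=I_T-T^{-1}\iota\iota'$ with $\iota=(1,\dots,1)'$, and $v_i=(\rho-1)y_{i,0}+\alpha_i+T^{-1}\iota'X_i\beta$. Assume that the vectors $(\varepsilon_i,v_i,QX_i)$ are i.i.d. over $i$; that $E(v_i)=0$ and $\mathrm{Var}(v_i)<\infty$; that $E(X_i'QX_i)$ is finite and positive definite; that $\varepsilon_i$ is independent of $(v_i,QX_i)$; and that $E(\varepsilon_i)=0$ and $\mathrm{Var}(\varepsilon_i)=\sigma^2I_T$ with $0<\sigma^2<\infty$. Assume moreover that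 $E(\varepsilon_{1,t}^4)<\infty$ for all $t$ and that the random variable $\bigl(\sum_{t=1}^T\varepsilon_{1,t}\bigr)\bigl(\sum_{t=1}^T(t-\tfrac{T+1}{2})\varepsilon_{1,t}\bigr)$ is not almost surely zero (both hold if $\varepsilon_i\sim N(0,\sigma^2I_T)$). For $\theta=(r,s^2,b)$ with $s^2>0$ let $$\widetilde l_N(\theta)=(T-1)\xi(r)-\frac{T-1}{2}\log s^2-\frac{1}{2s^2N}\sum_{i=1}^N(y_i-ry_{i,-1}-X_ib)'Q(y_i-ry_{i,-1}-X_ib),$$ $$\xi(r)=\frac{1}{T(T-1)}\sum_{t=1}^{T-1}\frac{T-t}{t}r^t,$$ be the modified profile log-likelihood, and let $\widetilde l_N^c(r)=\widetilde l_N\bigl(r,\widehat\sigma^2(r,\widehat\beta(r)),\widehat\beta(r)\bigr)$ be the modified profile log-likelihood of $r$, where $\widehat\beta(r)=(\sum_{i\le N}X_i'QX_i)^{-1}\sum_{i\le N}X_i'Q(y_i-ry_{i,-1})$ and $\widehat\sigma^2(r,b)=\frac{1}{(T-1)N}\sum_{i\le N}(y_i-ry_{i,-1}-X_ib)'Q(y_i-ry_{i,-1}-X_ib)$.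 Let $\rho=1$. Then: (a) If $\widetilde\Theta_N^c$ denotes the set of roots of $\partial\widetilde l_N^c/\partial r=0$ on $[-1,\infty)$ at which $\widetilde l_N^c$ has a local maximum on $[-1,\infty)$, then $\lim_{N\to\infty}\Pr(\widetilde\Theta_N^c=\varnothing)$ exists and is positive. (b) For an open set $\Omega\subseteq\mathbb R\times(0,\infty)\times\mathbb R^K$ let $\Theta_N$ be the set of roots in $\Omega$ of $\partial\widetilde l_N/\partial\theta=0$ at which $\widetilde l_N$ has a local maximum on $\Omega$, and let $\widetilde\Omega=[-1,\infty)\times(0,\infty)\times\mathbb R^K$. If $\widetilde\Omega\subseteq\Omega$, then $\lim_{N\to\infty}\Pr(\Theta_N\cap\widetilde\Omega=\varnothing)$ exists and is positive. (c) For every such open set $\Omega$ (containing $\widetilde\Omega$ or not), Lancaster's estimator, i.e. any $\widehat\theta_N$ with $\widehat\theta_N\in\Theta_N$ when $\Theta_N\neq\varnothing$ and $\widehat\theta_N=0$ when $\Theta_N=\varnothing$, does not converge in probability to $\theta_0=(\rho,\sigma^2,\beta)=(1,\sigma^2,0)$. -/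

import Mathlib

open MeasureTheory ProbabilityTheory Filter Topology
open scoped Matrix

noncomputable section

namespace PanelAR1

/-! Realised panels: `y i : Fin (T + 1) → ℝ` holds `y_{i,0}, …, y_{i,T}` and
`X i : Matrix (Fin T) (Fin K) ℝ` holds the covariates of unit `i`.  Units are numbered from `0`,
and the sample of size `N` consists of the units `0, …, N - 1`. -/

variable {T K : ℕ}

/-- The vector `y_i = (y_{i,1}, …, y_{i,T})`. -/
def lead (yi : Fin (T + 1) → ℝ) : Fin T → ℝ := fun t => yi t.succ

/-- The vector `y_{i,-1} = (y_{i,0}, …, y_{i,T-1})`. -/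
def lag (yi : Fin (T + 1) → ℝ) : Fin T → ℝ := fun t => yi t.castSucc

/-- The within projection `Q = I_T - T⁻¹ ι ι'`. -/
def Q (T : ℕ) : Matrix (Fin T) (Fin T) ℝ :=
  1 - (T : ℝ)⁻¹ • Matrix.of (fun _ _ => (1 : ℝ))

/-- `ξ(r) = (T (T - 1))⁻¹ ∑_{t=1}^{T-1} ((T - t) / t) r ^ t`. -/
def xi (T : ℕ) (r : ℝ) : ℝ :=
  1 / ((T : ℝ) * ((T : ℝ) - 1)) * ∑ t ∈ Finset.Ico 1 T, ((T : ℝ) - t) / t * r ^ t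

/-- The residual vector `y_i - r y_{i,-1} - X_i b`. -/
def resid (yi : Fin (T + 1) → ℝ) (Xi : Matrix (Fin T) (Fin K) ℝ) (r : ℝ) (b : Fin K → ℝ) :
    Fin T → ℝ :=
  lead yi - r • lag yi - Xi *ᵥ b

/-- `N⁻¹ ∑_i (y_i - r y_{i,-1} - X_i b)' Q (y_i - r y_{i,-1} - X_i b)`. -/
def meanSq (y : ℕ → Fin (T + 1) → ℝ) (X : ℕ → Matrix (Fin T) (Fin K) ℝ) (N : ℕ)
    (r : ℝ) (b : Fin K → ℝ) : ℝ :=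
  (N : ℝ)⁻¹ * ∑ i ∈ Finset.range N,
    resid (y i) (X i) r b ⬝ᵥ (Q T *ᵥ resid (y i) (X i) r b)

/-- The normalised modified profile log-likelihood `l̃_N(r, s², b)`. -/
def modLogLik (y : ℕ → Fin (T + 1) → ℝ) (X : ℕ → Matrix (Fin T) (Fin K) ℝ) (N : ℕ)
    (r s2 : ℝ) (b : Fin K → ℝ) : ℝ :=
  ((T : ℝ) - 1) * xi T r
    + (-(((T : ℝ) - 1) / 2) * Real.log s2 - 1 / (2 * s2) * meanSq y X N r b)

/-- `β̂(r) = (∑_i X_i' Q X_i)⁻¹ ∑_i X_i' Q (y_i - r y_{i,-1})`. -/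
def betaHat (y : ℕ → Fin (T + 1) → ℝ) (X : ℕ → Matrix (Fin T) (Fin K) ℝ) (N : ℕ)
    (r : ℝ) : Fin K → ℝ :=
  (∑ i ∈ Finset.range N, (X i)ᵀ * Q T * X i)⁻¹ *ᵥ
    ∑ i ∈ Finset.range N, ((X i)ᵀ * Q T) *ᵥ (lead (y i) - r • lag (y i))

/-- `σ̂²(r, b) = (T - 1)⁻¹ N⁻¹ ∑_i (y_i - r y_{i,-1} - X_i b)' Q (y_i - r y_{i,-1} - X_i b)`. -/
def sigma2Hat (y : ℕ → Fin (T + 1) → ℝ) (X : ℕ → Matrix (Fin T) (Fin K) ℝ) (N : ℕ)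
    (r : ℝ) (b : Fin K → ℝ) : ℝ :=
  ((T : ℝ) - 1)⁻¹ * meanSq y X N r b

/-- The modified profile log-likelihood of `r`:
`l̃_N^c(r) = l̃_N(r, σ̂²(r, β̂(r)), β̂(r))`. -/
def profLogLik (y : ℕ → Fin (T + 1) → ℝ) (X : ℕ → Matrix (Fin T) (Fin K) ℝ) (N : ℕ)
    (r : ℝ) : ℝ :=
  modLogLik y X N r (sigma2Hat y X N r (betaHat y X N r)) (betaHat y X N r)

/-- The roots of `∂ l̃_N^c / ∂ r = 0` on `[-1, ∞)` at which `l̃_N^c` has a local maximum on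
`[-1, ∞)`. -/
def profMaxima (y : ℕ → Fin (T + 1) → ℝ) (X : ℕ → Matrix (Fin T) (Fin K) ℝ) (N : ℕ) :
    Set ℝ :=
  {r | r ∈ Set.Ici (-1 : ℝ) ∧ HasDerivAt (profLogLik y X N) 0 r ∧
    IsLocalMaxOn (profLogLik y X N) (Set.Ici (-1 : ℝ)) r}

/-- Parameters `θ = (r, s², b)`. -/
abbrev Param (K : ℕ) : Type := ℝ × ℝ × (Fin K → ℝ)

/-- `ℝ × ℝ⁺ × ℝ^K`. -/
def fullParam (K : ℕ) : Set (Param K) := {θ | 0 < θ.2.1}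

/-- `[-1, ∞) × (0, ∞) × ℝ^K`. -/
def restrParam (K : ℕ) : Set (Param K) := {θ | -1 ≤ θ.1 ∧ 0 < θ.2.1}

/-- The roots in `S` of `∂ l̃_N / ∂ θ = 0` at which `l̃_N` has a local maximum on `S`. -/
def jointMaxima (S : Set (Param K)) (y : ℕ → Fin (T + 1) → ℝ)
    (X : ℕ → Matrix (Fin T) (Fin K) ℝ) (N : ℕ) : Set (Param K) :=
  {θ | θ ∈ S ∧
    HasFDerivAt (fun η : Param K => modLogLik y X N η.1 η.2.1 η.2.2)
      (0 : Param K →L[ℝ] ℝ) θ ∧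
    IsLocalMaxOn (fun η : Param K => modLogLik y X N η.1 η.2.1 η.2.2) S θ}

variable {Ω : Type*} [MeasurableSpace Ω]

/-- `v_i = (ρ - 1) y_{i,0} + α_i + x̄_i' β` with `α_i = (1 - ρ) μ_i`, `β = (1 - ρ) β̌` and
`x̄_i' = T⁻¹ ι' X_i`. -/
def effect (ρ : ℝ) (βc : Fin K → ℝ) (μ : ℕ → Ω → ℝ) (y : ℕ → Ω → Fin (T + 1) → ℝ)
    (X : ℕ → Ω → Matrix (Fin T) (Fin K) ℝ) (i : ℕ) (ω : Ω) : ℝ :=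
  (ρ - 1) * y i ω 0 + (1 - ρ) * μ i ω
    + (fun k => (T : ℝ)⁻¹ * ∑ t, X i ω t k) ⬝ᵥ ((1 - ρ) • βc)

/-- The entries of `Q X_i`. -/
def demeaned (X : ℕ → Ω → Matrix (Fin T) (Fin K) ℝ) (i : ℕ) (ω : Ω) :
    Fin T → Fin K → ℝ :=
  fun t k => (Q T * X i ω) t k

/-- The panel AR(1) model with strictly exogenous covariates, individual effects
`α_i = (1 - ρ) μ_i` and slope `β = (1 - ρ) β̌`, together with its sampling assumptions. -/
structure Model (P : Measure Ω) (ρ σ2 : ℝ) (βc : Fin K → ℝ) (μ : ℕ → Ω → ℝ)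
    (y : ℕ → Ω → Fin (T + 1) → ℝ) (X : ℕ → Ω → Matrix (Fin T) (Fin K) ℝ)
    (ε : ℕ → Ω → Fin T → ℝ) : Prop where
  /-- `y_{i,t} = ρ y_{i,t-1} + x_{i,t}' β + α_i + ε_{i,t}` for `t = 1, …, T`. -/
  eqn : ∀ i, ∀ᵐ ω ∂P, ∀ t : Fin T,
    y i ω t.succ = ρ * y i ω t.castSucc + (X i ω *ᵥ ((1 - ρ) • βc)) t
      + (1 - ρ) * μ i ω + ε i ω t
  two_le : 2 ≤ T
  rho_ge : -1 ≤ ρ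
  rho_le : ρ ≤ 1
  sigma2_pos : 0 < σ2
  /-- The vectors `(ε_i, v_i, Q X_i)` are independent across `i` … -/
  indep : iIndepFun (fun i ω => (ε i ω, effect ρ βc μ y X i ω, demeaned X i ω)) P
  /-- … and identically distributed. -/
  ident : ∀ i, IdentDistrib
    (fun ω => (ε i ω, effect ρ βc μ y X i ω, demeaned X i ω))
    (fun ω => (ε 0 ω, effect ρ βc μ y X 0 ω, demeaned X 0 ω)) P P
  /-- `v_i` has a finite variance and mean zero. -/
  effect_memLp : ∀ i, MemLp (effect ρ βc μ y X i) 2 P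
  effect_mean : ∀ i, ∫ ω, effect ρ βc μ y X i ω ∂P = 0
  /-- `E (X_i' Q X_i)` is finite and positive definite. -/
  cov_integrable : ∀ i k l, Integrable (fun ω => ((X i ω)ᵀ * Q T * X i ω) k l) P
  cov_posDef : ∀ i,
    (Matrix.of fun k l => ∫ ω, ((X i ω)ᵀ * Q T * X i ω) k l ∂P).PosDef
  /-- `ε_i` is independent of `(v_i, Q X_i)`. -/
  exog : ∀ i, IndepFun (ε i) (fun ω => (effect ρ βc μ y X i ω, demeaned X i ω)) P
  /-- `E ε_i = 0` and `Var ε_i = σ² I_T`. -/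
  eps_memLp : ∀ i t, MemLp (fun ω => ε i ω t) 2 P
  eps_mean : ∀ i t, ∫ ω, ε i ω t ∂P = 0
  eps_var : ∀ i s t, ∫ ω, ε i ω s * ε i ω t ∂P = if s = t then σ2 else 0

/-- `θ̂` is a version of Lancaster's estimator on the parameter set `S`: it selects a local
maximum of `l̃_N` on `S` that is a stationary point, and it is put equal to `0` if there is
none. -/
def IsLancaster (S : Set (Param K)) (y : ℕ → Ω → Fin (T + 1) → ℝ)
    (X : ℕ → Ω → Matrix (Fin T) (Fin K) ℝ) (θhat : ℕ → Ω → Param K) : Prop :=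
  ∀ N ω,
    ((jointMaxima S (fun i => y i ω) (fun i => X i ω) N).Nonempty →
      θhat N ω ∈ jointMaxima S (fun i => y i ω) (fun i => X i ω) N) ∧
    (jointMaxima S (fun i => y i ω) (fun i => X i ω) N = ∅ → θhat N ω = 0)

end PanelAR1

end

/-! At `ρ = 1` the slope is zero and each unit is a random walk in its errors started at `y_{i,0}`,
which `Q` removes. Concentrating out `b` and `s²` leaves, up to a constant, `(T - 1) (ξ(r) - log
S(r) / 2)` with `S(r) = A - 2 (r - 1) B + (r - 1) ^ 2 C`, so stationarity in `r` means that `score`,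
the numerator `ξ' S - S' / 2`, vanishes. In the population `(A, B, C)` is proportional to `(1, -1/2,
(T + 1) / 6)`, and the score then has a double zero at `r = 1` and is positive elsewhere on `[-1,
∞)` (`score_limit_ge`): the limiting profile likelihood has a point of inflection at the true value.

Sampling error breaks this tie. If the coefficients are within `m` of their limits, the score moves
by `Z = A / 2 + B`, its value at `r = 1`, plus at most a multiple of `m (|r - 1| + (r - 1) ^ 2)`
times a growth factor. Against the quadratic lower bound the second part costs only `O(m ^ 2)`. If
`Z` exceeds this cost the score has no zero on `[-1, ∞)` (`NearLimit.score_pos`); if `Z < 0` the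
score is positive at `0` and negative at `1`, so a local maximum lies between them.

Partialling out the covariates changes `Z` only to second order, so `Z` is essentially the i.i.d.
average `scoreAvg`, and `√N` times that average is asymptotically a nondegenerate centred normal
variable. As `m ^ 2` can be taken to be an arbitrarily small multiple of `N ^ (-1/2)`, the
probability that no maximum exists tends to the normal mass of the positive half-line. On the event
`√N * scoreAvg > 1`, whose limiting probability is positive, the estimator is, up to a negligible
event, either the default `0` or has `r < -1`; both are at distance at least `1` from the truth. -/

noncomputable section

namespace PanelAR1

/-! ### The derivative of `ξ` and its growth -/

section

/-- `∑_{j < m} (m - j) x ^ j`, which is `(x ^ (m + 1) - 1 - (m + 1) (x - 1)) / (x - 1) ^ 2`. -/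
def cesaroPoly (m : ℕ) (x : ℝ) : ℝ := ∑ j ∈ Finset.range m, ((m : ℝ) - j) * x ^ j

lemma cesaroPoly_succ (m : ℕ) (x : ℝ) :
    cesaroPoly (m + 1) x = cesaroPoly m x + ∑ j ∈ Finset.range (m + 1), x ^ j := by
  unfold cesaroPoly
  rw [Finset.sum_range_succ, Finset.sum_range_succ _ m, ← add_assoc, ← Finset.sum_add_distrib]
  push_cast
  congr 1
  · exact Finset.sum_congr rfl fun j _ => by ring
  · ring

lemma sub_one_sq_mul_cesaroPoly (m : ℕ) (x : ℝ) :
    (x - 1) ^ 2 * cesaroPoly m x = x ^ (m + 1) - 1 - ((m : ℝ) + 1) * (x - 1) := by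
  induction m with
  | zero => simp [cesaroPoly]
  | succ m ih =>
    have h := geom_sum_mul x (m + 1)
    rw [cesaroPoly_succ, mul_add, ih]
    push_cast
    linear_combination (x - 1) * h

lemma cesaroPoly_one (m : ℕ) : cesaroPoly m 1 = (m : ℝ) * (m + 1) / 2 := by
  induction m with
  | zero => simp [cesaroPoly]
  | succ m ih =>
    rw [cesaroPoly_succ, ih]
    simp
    ring

lemma sum_weighted_range (m : ℕ) :
    ∑ j ∈ Finset.range m, ((m : ℝ) - j) * ((j : ℝ) + 1) = m * (m + 1) * (m + 2) / 6 := by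
  have h2 : ∀ n : ℕ, ∑ j ∈ Finset.range n, ((j : ℝ) + 1) = n * (n + 1) / 2 := by
    intro n
    induction n with
    | zero => simp
    | succ n ih => rw [Finset.sum_range_succ, ih]; push_cast; ring
  induction m with
  | zero => simp
  | succ m ih =>
    have h : ∑ j ∈ Finset.range (m + 1), (((m + 1 : ℕ) : ℝ) - j) * ((j : ℝ) + 1)
        = ∑ j ∈ Finset.range m, ((m : ℝ) - j) * ((j : ℝ) + 1)
          + ∑ j ∈ Finset.range (m + 1), ((j : ℝ) + 1) := by
      rw [Finset.sum_range_succ, Finset.sum_range_succ _ m, ← add_assoc,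
        ← Finset.sum_add_distrib]
      push_cast
      congr 1
      · exact Finset.sum_congr rfl fun j _ => by ring
      · ring
    rw [h, ih, h2]
    push_cast
    ring

/-- The growth factor `1 + |x| ^ n`. -/
def growth (n : ℕ) (x : ℝ) : ℝ := 1 + |x| ^ n

lemma one_le_growth (n : ℕ) (x : ℝ) : 1 ≤ growth n x := by
  have : 0 ≤ |x| ^ n := by positivity
  unfold growth; linarith

lemma abs_pow_le_growth {j n : ℕ} (h : j ≤ n) (x : ℝ) : |x| ^ j ≤ growth n x := by
  unfold growth
  rcases le_total |x| 1 with hx | hx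
  · have := pow_le_one₀ (n := j) (abs_nonneg x) hx
    have : 0 ≤ |x| ^ n := by positivity
    linarith
  · have := pow_le_pow_right₀ hx h
    linarith

/-- For `x ≥ 0` the terms `j = 0` and `j = m` suffice. For `-1 ≤ x ≤ 0` multiply by `1 - x`: the
result is a sum of terms `1 - x ^ (i + 1) ≥ 0`, whose first is `1 - x`, so the polynomial is at
least `1`, while the growth factor is at most `2`. -/
lemma growth_le_cesaroPoly (m : ℕ) {x : ℝ} (hx : -1 ≤ x) :
    growth m x / 2 ≤ cesaroPoly (m + 1) x := by
  unfold growth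
  rcases le_total 0 x with h0 | h0
  · rw [abs_of_nonneg h0]
    rcases Nat.eq_zero_or_pos m with rfl | hm
    · simp [cesaroPoly]
    · have h1 : ∑ j ∈ {0, m}, (((m + 1 : ℕ) : ℝ) - j) * x ^ j ≤ cesaroPoly (m + 1) x := by
        apply Finset.sum_le_sum_of_subset_of_nonneg
        · intro j hj
          simp only [Finset.mem_insert, Finset.mem_singleton] at hj
          rw [Finset.mem_range]
          omega
        · intro j hj _
          have : (j : ℝ) ≤ ((m + 1 : ℕ) : ℝ) := by
            exact_mod_cast (Finset.mem_range.1 hj).le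
          exact mul_nonneg (by linarith) (pow_nonneg h0 _)
      rw [Finset.sum_pair (by omega)] at h1
      push_cast at h1
      have h2 : 0 ≤ x ^ m := pow_nonneg h0 _
      have h3 : (0 : ℝ) ≤ m := by positivity
      simp only [pow_zero] at h1
      linarith
  · have habs : |x| ≤ 1 := abs_le.2 ⟨hx, by linarith⟩
    have hp : |x| ^ m ≤ 1 := pow_le_one₀ (abs_nonneg x) habs
    have h1 : 1 ≤ cesaroPoly (m + 1) x := by
      have h2 : ∀ k : ℕ, (1 - x) ≤ (1 - x) * cesaroPoly (k + 1) x := by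
        intro k
        induction k with
        | zero => simp [cesaroPoly]
        | succ k ih =>
          rw [cesaroPoly_succ, mul_add]
          have h3 : (1 - x) * ∑ j ∈ Finset.range (k + 1 + 1), x ^ j = 1 - x ^ (k + 1 + 1) := by
            have := geom_sum_mul x (k + 1 + 1)
            linear_combination -this
          have h4 : x ^ (k + 1 + 1) ≤ 1 :=
            (le_abs_self _).trans ((abs_pow x _).le.trans (pow_le_one₀ (abs_nonneg x) habs))
          rw [h3]
          linarith
      have h5 : 0 < 1 - x := by linarith
      have := h2 m
      nlinarith
    linarith

/-- The derivative of `ξ`. -/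
def xiDeriv (T : ℕ) (x : ℝ) : ℝ := cesaroPoly (T - 1) x / ((T : ℝ) * ((T : ℝ) - 1))

lemma hasDerivAt_xi (T : ℕ) (x : ℝ) : HasDerivAt (xi T) (xiDeriv T x) x := by
  have h : HasDerivAt (fun r : ℝ => 1 / ((T : ℝ) * ((T : ℝ) - 1)) *
      ∑ t ∈ Finset.Ico 1 T, ((T : ℝ) - t) / t * r ^ t)
      (1 / ((T : ℝ) * ((T : ℝ) - 1)) *
        ∑ t ∈ Finset.Ico 1 T, ((T : ℝ) - t) / t * (t * x ^ (t - 1))) x := by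
    refine HasDerivAt.const_mul _ (HasDerivAt.fun_sum fun t _ => ?_)
    exact (hasDerivAt_pow t x).const_mul _
  convert! h using 1
  unfold xiDeriv cesaroPoly
  rw [div_eq_mul_one_div, mul_comm, Finset.sum_Ico_eq_sum_range]
  congr 1
  refine Finset.sum_congr rfl fun j hj => ?_
  have hj' := Finset.mem_range.1 hj
  have hT : ((T - 1 : ℕ) : ℝ) = (T : ℝ) - 1 := by
    rw [Nat.cast_sub (by omega)]; simp
  have hj0 : ((1 + j : ℕ) : ℝ) ≠ 0 := by positivity
  rw [hT, Nat.add_sub_cancel_left]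
  push_cast at hj0 ⊢
  field_simp
  ring

lemma xiDeriv_eq (n : ℕ) (x : ℝ) :
    xiDeriv (n + 2) x = cesaroPoly (n + 1) x / (((n : ℝ) + 2) * ((n : ℝ) + 1)) := by
  unfold xiDeriv
  push_cast
  congr 2
  ring

lemma xiDeriv_one (n : ℕ) : xiDeriv (n + 2) 1 = 1 / 2 := by
  rw [xiDeriv_eq, cesaroPoly_one]
  push_cast
  have : (n : ℝ) + 1 ≠ 0 := by positivity
  have : (n : ℝ) + 2 ≠ 0 := by positivity
  field_simp
  ring

/-- Each `x ^ j - 1` is `x - 1` times a geometric sum of at most `n` powers, all bounded by the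
growth factor. -/
lemma abs_cesaroPoly_sub_le (n : ℕ) (x : ℝ) :
    |cesaroPoly (n + 1) x - cesaroPoly (n + 1) 1|
      ≤ (n * |x - 1| * growth n x) * (((n : ℝ) + 1) * (n + 2) / 2) := by
  have h1 : cesaroPoly (n + 1) x - cesaroPoly (n + 1) 1
      = ∑ j ∈ Finset.range (n + 1), (((n + 1 : ℕ) : ℝ) - j) * (x ^ j - 1) := by
    unfold cesaroPoly
    rw [← Finset.sum_sub_distrib]
    exact Finset.sum_congr rfl fun j _ => by rw [one_pow]; ring
  have h2 : (((n : ℝ) + 1) * (n + 2) / 2) = ∑ j ∈ Finset.range (n + 1), (((n + 1 : ℕ) : ℝ) - j) := by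
    have := cesaroPoly_one (n + 1)
    unfold cesaroPoly at this
    simp only [one_pow, mul_one] at this
    rw [this]; push_cast; ring
  rw [h1, h2, Finset.mul_sum]
  refine (Finset.abs_sum_le_sum_abs _ _).trans (Finset.sum_le_sum fun j hj => ?_)
  have hj' := Finset.mem_range.1 hj
  have hnn : 0 ≤ ((n + 1 : ℕ) : ℝ) - j := by
    have : (j : ℝ) ≤ ((n + 1 : ℕ) : ℝ) := by exact_mod_cast hj'.le
    linarith
  rw [abs_mul, abs_of_nonneg hnn, mul_comm]
  refine mul_le_mul_of_nonneg_right ?_ hnn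
  rw [← geom_sum_mul x j, abs_mul]
  have h3 : |∑ i ∈ Finset.range j, x ^ i| ≤ n * growth n x := by
    refine (Finset.abs_sum_le_sum_abs _ _).trans ?_
    have h4 : ∑ i ∈ Finset.range j, |x ^ i| ≤ ∑ i ∈ Finset.range j, growth n x := by
      refine Finset.sum_le_sum fun i hi => ?_
      have := Finset.mem_range.1 hi
      rw [abs_pow]
      exact abs_pow_le_growth (by omega) x
    refine h4.trans ?_
    rw [Finset.sum_const, Finset.card_range, nsmul_eq_mul]
    have : (j : ℝ) ≤ n := by exact_mod_cast (by omega : j ≤ n)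
    exact mul_le_mul_of_nonneg_right this (by linarith [one_le_growth n x])
  calc |∑ i ∈ Finset.range j, x ^ i| * |x - 1| ≤ (n * growth n x) * |x - 1| :=
        mul_le_mul_of_nonneg_right h3 (abs_nonneg _)
    _ = n * |x - 1| * growth n x := by ring

lemma abs_xiDeriv_sub_le (n : ℕ) (x : ℝ) :
    |xiDeriv (n + 2) x - 1 / 2| ≤ n * |x - 1| * growth n x / 2 := by
  have hpos : 0 < ((n : ℝ) + 2) * ((n : ℝ) + 1) := by positivity
  rw [← xiDeriv_one n, xiDeriv_eq, xiDeriv_eq, ← sub_div, abs_div, abs_of_pos hpos,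
    div_le_iff₀ hpos]
  refine (abs_cesaroPoly_sub_le n x).trans (le_of_eq ?_)
  ring

lemma abs_xiDeriv_le (n : ℕ) (x : ℝ) : |xiDeriv (n + 2) x| ≤ growth n x / 2 := by
  have hpos : 0 < ((n : ℝ) + 2) * ((n : ℝ) + 1) := by positivity
  rw [xiDeriv_eq, abs_div, abs_of_pos hpos, div_le_iff₀ hpos]
  have h2 : cesaroPoly (n + 1) 1 = ∑ j ∈ Finset.range (n + 1), (((n + 1 : ℕ) : ℝ) - j) := by
    unfold cesaroPoly; simp
  rw [cesaroPoly_one] at h2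
  have h3 : |cesaroPoly (n + 1) x|
      ≤ ∑ j ∈ Finset.range (n + 1), growth n x * (((n + 1 : ℕ) : ℝ) - j) := by
    refine (Finset.abs_sum_le_sum_abs _ _).trans (Finset.sum_le_sum fun j hj => ?_)
    have hj' := Finset.mem_range.1 hj
    have hnn : 0 ≤ ((n + 1 : ℕ) : ℝ) - j := by
      have : (j : ℝ) ≤ ((n + 1 : ℕ) : ℝ) := by exact_mod_cast hj'.le
      linarith
    rw [abs_mul, abs_of_nonneg hnn, mul_comm, abs_pow]
    exact mul_le_mul_of_nonneg_right (abs_pow_le_growth (by omega) x) hnn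
  rw [← Finset.mul_sum, ← h2] at h3
  refine h3.trans (le_of_eq ?_)
  push_cast
  ring

/-! ### The profile score and its perturbation around the double zero at `1` -/

/-- The numerator `ξ'(x) S(x) - S'(x) / 2` of the profile score for
`S(x) = A - 2 (x - 1) B + (x - 1) ^ 2 C`. -/
def score (T : ℕ) (A B C x : ℝ) : ℝ :=
  xiDeriv T x * (A - 2 * (x - 1) * B + (x - 1) ^ 2 * C) + B - (x - 1) * C

/-- With `B = -1/2` the linear part of `S` is `1 + (x - 1) = x`. The score therefore splits into a
positive multiple of `x * cesaroPoly (n + 1) x` minus its tangent at `1`, which is nonnegative by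
Bernoulli's inequality applied power by power (valid from `x ≥ -1`), and the term `(x - 1) ^ 2 * C *
ξ'`, which gives the bound. -/
lemma score_limit_ge (n : ℕ) {x : ℝ} (hx : -1 ≤ x) :
    (x - 1) ^ 2 * growth n x / (4 * ((n + 2) * (n + 1)))
      ≤ score (n + 2) 1 (-1 / 2) (((n : ℝ) + 3) / 6) x := by
  have hn : (0 : ℝ) ≤ n := by positivity
  have hpos : 0 < ((n : ℝ) + 2) * ((n : ℝ) + 1) := by positivity
  have hg := sub_one_sq_mul_cesaroPoly (n + 1) x
  have hS0 : ∑ j ∈ Finset.range (n + 1), (((n + 1 : ℕ) : ℝ) - j)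
      = ((n : ℝ) + 1) * (n + 2) / 2 := by
    have := cesaroPoly_one (n + 1)
    unfold cesaroPoly at this
    simp only [one_pow, mul_one] at this
    rw [this]; push_cast; ring
  have hS1 := sum_weighted_range (n + 1)
  have hbern : 0 ≤ x * cesaroPoly (n + 1) x - ((n : ℝ) + 1) * (n + 2) / 2
      - (x - 1) * (((n : ℝ) + 1) * (n + 2) * (n + 3) / 6) := by
    have h1 : x * cesaroPoly (n + 1) x - ((n : ℝ) + 1) * (n + 2) / 2
        - (x - 1) * (((n : ℝ) + 1) * (n + 2) * (n + 3) / 6)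
        = ∑ j ∈ Finset.range (n + 1), (((n + 1 : ℕ) : ℝ) - j)
          * (x ^ (j + 1) - 1 - (x - 1) * (j + 1)) := by
      have : ((n : ℝ) + 1) * (n + 2) * (n + 3) / 6
          = ((n + 1 : ℕ) : ℝ) * ((n + 1 : ℕ) + 1) * ((n + 1 : ℕ) + 2) / 6 := by
        push_cast; ring
      rw [this, ← hS0, ← hS1]
      unfold cesaroPoly
      rw [Finset.mul_sum, Finset.mul_sum, ← Finset.sum_sub_distrib, ← Finset.sum_sub_distrib]
      exact Finset.sum_congr rfl fun j _ => by ring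
    rw [h1]
    refine Finset.sum_nonneg fun j hj => mul_nonneg ?_ ?_
    · have : (j : ℝ) ≤ ((n + 1 : ℕ) : ℝ) := by exact_mod_cast (Finset.mem_range.1 hj).le
      linarith
    · have := one_add_mul_le_pow (by linarith : -2 ≤ x - 1) (j + 1)
      rw [add_sub_cancel] at this
      push_cast at this
      linarith
  have hlow := growth_le_cesaroPoly n hx
  have hd : 0 ≤ (x - 1) ^ 2 := sq_nonneg _
  have hgr := one_le_growth n x
  rw [div_le_iff₀ (by positivity)]
  unfold score
  rw [xiDeriv_eq]
  have hexp : (cesaroPoly (n + 1) x / (((n : ℝ) + 2) * (n + 1))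
      * (1 - 2 * (x - 1) * (-1 / 2) + (x - 1) ^ 2 * ((n + 3) / 6)) + -1 / 2
        - (x - 1) * ((n + 3) / 6)) * (4 * ((n + 2) * (n + 1)))
      = 4 * (x * cesaroPoly (n + 1) x - ((n : ℝ) + 1) * (n + 2) / 2
          - (x - 1) * (((n : ℝ) + 1) * (n + 2) * (n + 3) / 6))
        + 4 * ((n + 3) / 6) * ((x - 1) ^ 2 * cesaroPoly (n + 1) x) := by
    field_simp
    ring
  rw [hexp]
  have h5 : (x - 1) ^ 2 * (growth n x / 2) ≤ (x - 1) ^ 2 * cesaroPoly (n + 1) x :=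
    mul_le_mul_of_nonneg_left hlow hd
  have h6 : 0 ≤ (x - 1) ^ 2 * growth n x := mul_nonneg hd (by linarith)
  nlinarith

/-- The score is linear in the coefficients, with weights `1/2`, `1` and `0` at `x = 1`. What
remains after subtracting these weights vanishes at `1` and is controlled by the bounds on `ξ'`. -/
lemma score_sub_bound (n : ℕ) {A B C A' B' C' m x : ℝ} (hA : |A - A'| ≤ m) (hB : |B - B'| ≤ m)
    (hC : |C - C'| ≤ m) :
    |score (n + 2) A B C x - score (n + 2) A' B' C' x - ((A - A') / 2 + (B - B'))|
      ≤ (n + 2) * m * growth n x * (|x - 1| + (x - 1) ^ 2) := by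
  have hm : 0 ≤ m := (abs_nonneg _).trans hA
  have hn : (0 : ℝ) ≤ n := by positivity
  have hg := one_le_growth n x
  set W := growth n x
  set e := |x - 1| with he
  have hee : (x - 1) ^ 2 = e ^ 2 := (sq_abs _).symm
  have he0 : 0 ≤ e := abs_nonneg _
  have h1 := abs_xiDeriv_sub_le n x
  have h2 := abs_xiDeriv_le n x
  set f := xiDeriv (n + 2) x with hf
  have hexp : score (n + 2) A B C x - score (n + 2) A' B' C' x - ((A - A') / 2 + (B - B'))
      = (A - A') * (f - 1 / 2) + (B - B') * (-2 * (x - 1) * f)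
        + (C - C') * ((x - 1) ^ 2 * f - (x - 1)) := by
    unfold score; ring
  have k1 : |(A - A') * (f - 1 / 2)| ≤ m * (n * e * W / 2) := by
    rw [abs_mul]; exact mul_le_mul hA h1 (abs_nonneg _) hm
  have k2 : |(B - B') * (-2 * (x - 1) * f)| ≤ m * (e * W) := by
    rw [abs_mul]
    refine mul_le_mul hB ?_ (abs_nonneg _) hm
    rw [abs_mul, abs_mul, abs_neg, abs_two]
    nlinarith
  have k3 : |(C - C') * ((x - 1) ^ 2 * f - (x - 1))| ≤ m * (e ^ 2 * (W / 2) + e * W) := by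
    rw [abs_mul]
    refine mul_le_mul hC ?_ (abs_nonneg _) hm
    refine (abs_sub _ _).trans ?_
    rw [abs_mul, abs_of_nonneg (sq_nonneg _), hee]
    have : e ^ 2 * |f| ≤ e ^ 2 * (W / 2) := mul_le_mul_of_nonneg_left h2 (sq_nonneg _)
    have : e ≤ e * W := le_mul_of_one_le_right he0 hg
    linarith
  rw [hexp]
  refine (abs_add_three _ _ _).trans ?_
  rw [hee] at k3 ⊢
  have hmW : 0 ≤ m * W := mul_nonneg hm (by linarith)
  have e1 : 0 ≤ m * W * e := mul_nonneg hmW he0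
  have e2 : 0 ≤ m * W * e ^ 2 := mul_nonneg hmW (sq_nonneg _)
  have e3 : 0 ≤ n * (m * W * e) := mul_nonneg hn e1
  have e4 : 0 ≤ n * (m * W * e ^ 2) := mul_nonneg hn e2
  nlinarith

lemma score_smul (T : ℕ) (k A B C x : ℝ) :
    score T (k * A) (k * B) (k * C) x = k * score T A B C x := by
  unfold score; ring

/-- `(A, B, C)` is within `m` of the population values of the profile coefficients. -/
def NearLimit (n : ℕ) (s m A B C : ℝ) : Prop :=
  |A - s * (n + 1) * 1| ≤ m ∧ |B - s * (n + 1) * (-1 / 2)| ≤ m ∧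
    |C - s * (n + 1) * ((n + 3) / 6)| ≤ m

/-- The population coefficients satisfy `A / 2 + B = 0`, so the constant part of the perturbation is
the sample value `A / 2 + B` itself. -/
lemma NearLimit.score_ge {n : ℕ} {s m A B C x : ℝ} (hs : 0 < s) (h : NearLimit n s m A B C)
    (hx : -1 ≤ x) :
    A / 2 + B + growth n x * ((s / (4 * (n + 2)) - (n + 2) * m) * (x - 1) ^ 2
      - (n + 2) * m * |x - 1|) ≤ score (n + 2) A B C x := by
  have hn : (0 : ℝ) ≤ n := by positivity
  have h1 := score_sub_bound n (x := x) h.1 h.2.1 h.2.2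
  have h2 := mul_le_mul_of_nonneg_left (score_limit_ge n hx)
    (by positivity : 0 ≤ s * ((n : ℝ) + 1))
  rw [score_smul] at h1
  have h3 : s * ((n : ℝ) + 1) * ((x - 1) ^ 2 * growth n x / (4 * ((n + 2) * (n + 1))))
      = growth n x * (s / (4 * (n + 2)) * (x - 1) ^ 2) := by
    field_simp
  rw [h3] at h2
  have h4 := (abs_le.1 h1).1
  nlinarith

/-- With `k = s / (4 (n + 2))`, `M = (n + 2) m` and `e = |x - 1|`, the expression `(k - M) e ^ 2 - M
e` is never below `-M ^ 2 / k`. It can be negative only for `e < 2 M / k`, so close to `1` that the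
growth factor is at most `2 * 2 ^ n`. The threshold in `hZ` is `2 * 2 ^ n * M ^ 2 / k`. -/
lemma NearLimit.score_pos {n : ℕ} {s m A B C x : ℝ} (hs : 0 < s) (h : NearLimit n s m A B C)
    (hx : -1 ≤ x) (hm0 : 0 ≤ m) (hm : m ≤ s / (32 * (n + 2) ^ 2))
    (hZ : 8 * 2 ^ n * (n + 2) ^ 3 / s * m ^ 2 < A / 2 + B) : 0 < score (n + 2) A B C x := by
  refine lt_of_lt_of_le ?_ (h.score_ge hs hx)
  have hn : (0 : ℝ) ≤ n := by positivity
  set k := s / (4 * ((n : ℝ) + 2)) with hk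
  set M := ((n : ℝ) + 2) * m with hM
  have hM0 : 0 ≤ M := by positivity
  have hk0 : 0 < k := by positivity
  have hMk : M ≤ k / 8 := by
    have := mul_le_mul_of_nonneg_left hm (by positivity : (0 : ℝ) ≤ n + 2)
    refine this.trans (le_of_eq ?_)
    rw [hk]; field_simp; norm_num
  have hZ' : 2 * 2 ^ n * (M ^ 2 / k) < A / 2 + B := by
    refine lt_of_eq_of_lt ?_ hZ
    rw [hk, hM]; field_simp; ring
  have hg := one_le_growth n x
  set e := |x - 1| with he
  have hee : (x - 1) ^ 2 = e ^ 2 := (sq_abs _).symm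
  have he0 : 0 ≤ e := abs_nonneg _
  rw [hee]
  have hZ0 : 0 < A / 2 + B := lt_of_le_of_lt (by positivity) hZ'
  rcases le_total (2 * M) (k * e) with hcase | hcase
  · have : 0 ≤ (k - M) * e ^ 2 - M * e := by nlinarith [mul_nonneg he0 he0]
    have := mul_nonneg (by linarith : 0 ≤ growth n x) this
    linarith
  · have he1 : e ≤ 1 := by
      have : k * e ≤ k * 1 := by linarith
      exact le_of_mul_le_mul_left this hk0
    have hx2 : |x| ≤ 2 := by
      have : |x| ≤ |x - 1| + |(1 : ℝ)| := by
        simpa using abs_add_le (x - 1) 1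
      rw [abs_one] at this; linarith
    have hW : growth n x ≤ 2 * 2 ^ n := by
      unfold growth
      have h1 : |x| ^ n ≤ 2 ^ n := pow_le_pow_left₀ (abs_nonneg _) hx2 n
      have h2 : (1 : ℝ) ≤ 2 ^ n := one_le_pow₀ (by norm_num)
      linarith
    have hq : -(M ^ 2 / k) ≤ (k - M) * e ^ 2 - M * e := by
      have h1 : 0 ≤ (k * e - M) ^ 2 := sq_nonneg _
      have h3 : -(M ^ 2 / k) = -(M ^ 2) / k := by ring
      rw [h3, div_le_iff₀ hk0]
      have h4 : M * e ^ 2 * k ≤ (k / 2) * e ^ 2 * k := by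
        have : 0 ≤ e ^ 2 * k := by positivity
        nlinarith
      nlinarith
    have hr : 0 ≤ M ^ 2 / k := by positivity
    have h1 := mul_le_mul_of_nonneg_left hq (by linarith : 0 ≤ growth n x)
    have h2 := mul_le_mul_of_nonneg_right hW hr
    linarith

lemma NearLimit.score_zero_pos {n : ℕ} {s m A B C : ℝ} (hs : 0 < s) (h : NearLimit n s m A B C)
    (hm0 : 0 ≤ m) (hm : m ≤ s / (32 * (n + 2) ^ 2)) : 0 < score (n + 2) A B C 0 := by
  refine lt_of_lt_of_le ?_ (h.score_ge hs (by norm_num))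
  have hn : (0 : ℝ) ≤ n := by positivity
  have hMk : ((n : ℝ) + 2) * m ≤ s / (4 * ((n : ℝ) + 2)) / 8 := by
    have := mul_le_mul_of_nonneg_left hm (by positivity : (0 : ℝ) ≤ n + 2)
    refine this.trans (le_of_eq ?_)
    field_simp; norm_num
  have hg := one_le_growth n 0
  have hA := (abs_le.1 h.1).1
  have hB := (abs_le.1 h.2.1).1
  have hk0 : 0 < s / (4 * ((n : ℝ) + 2)) := by positivity
  rw [zero_sub, abs_neg, abs_one]
  set k := s / (4 * ((n : ℝ) + 2))
  set M := ((n : ℝ) + 2) * m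
  have hmM : 2 * m ≤ M := by
    have : 0 ≤ (n : ℝ) * m := by positivity
    have : M = n * m + 2 * m := by simp only [M]; ring
    linarith
  have h1 : k / 2 ≤ growth n 0 * ((k - M) * (-1) ^ 2 - M * 1) := by nlinarith
  linarith

/-- In units of `s (n + 1)` the limits satisfy `B ^ 2 = 1/4 < 1/2 ≤ A C`, and an error of `1/32`
keeps the strict inequality, as `17 ^ 2 < 31 * 15`. -/
lemma NearLimit.pos {n : ℕ} {s m A B C : ℝ} (hs : 0 < s) (h : NearLimit n s m A B C)
    (hm : m ≤ s / (32 * (n + 2) ^ 2)) : 0 < A ∧ B ^ 2 < A * C := by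
  obtain ⟨hA, hB, hC⟩ := h
  have hm0 : 0 ≤ m := (abs_nonneg _).trans hA
  have hn : (0 : ℝ) ≤ n := by positivity
  have hm' : m ≤ s * (n + 1) / 32 := by
    refine hm.trans ?_
    have h1 : s / (32 * ((n : ℝ) + 2) ^ 2) ≤ s / 32 := by
      apply div_le_div_of_nonneg_left hs.le (by norm_num)
      nlinarith
    have : s ≤ s * (n + 1) := by nlinarith
    linarith
  set A0 := s * ((n : ℝ) + 1) with hA0
  have hA00 : 0 < A0 := by positivity
  have hA1 := (abs_le.1 hA).1
  have hC1 := (abs_le.1 hC).1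
  have hB1 := abs_le.1 hB
  have hc : A0 / 2 ≤ A0 * ((n + 3) / 6) := by nlinarith
  have hApos : 31 / 32 * A0 ≤ A := by linarith
  have hCpos : 15 / 32 * A0 ≤ C := by linarith
  have hBsq : B ^ 2 ≤ (17 / 32 * A0) ^ 2 := by
    apply sq_le_sq'
    · linarith [hB1.1]
    · linarith [hB1.2]
  refine ⟨by linarith, lt_of_le_of_lt hBsq ?_⟩
  have : 31 / 32 * A0 * (15 / 32 * A0) ≤ A * C :=
    mul_le_mul hApos hCpos (by positivity) (by linarith)
  nlinarith

end

/-! ### From the profile score to maxima of the profile and joint likelihoods -/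

section

variable {T K : ℕ}

/-- `A - 2 (r - 1) B + (r - 1) ^ 2 C`. -/
def quad (A B C r : ℝ) : ℝ := A - 2 * (r - 1) * B + (r - 1) ^ 2 * C

lemma hasDerivAt_quad (A B C r : ℝ) :
    HasDerivAt (quad A B C) (-2 * B + 2 * (r - 1) * C) r := by
  have h1 : HasDerivAt (fun r : ℝ => r - 1) 1 r := (hasDerivAt_id r).sub_const 1
  have h := ((h1.const_mul 2).mul_const B).const_sub A |>.add ((h1.pow 2).mul_const C)
  convert! h using 1
  simp

lemma quad_pos {A B C : ℝ} (hA : 0 < A) (h : B ^ 2 < A * C) (r : ℝ) : 0 < quad A B C r := by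
  have : 0 < A * quad A B C r := by
    have h1 : A * quad A B C r = (A - (r - 1) * B) ^ 2 + (r - 1) ^ 2 * (A * C - B ^ 2) := by
      unfold quad; ring
    rw [h1]
    rcases eq_or_ne (r - 1) 0 with h0 | h0
    · rw [h0]; nlinarith
    · have : 0 < (r - 1) ^ 2 * (A * C - B ^ 2) := mul_pos (by positivity) (by linarith)
      positivity
  exact pos_of_mul_pos_right this hA.le

/-- The mean sum of squares of the sample splits into its minimum over `b`, a quadratic polynomial
in `r` with coefficients `A, B, C`, and a positive definite quadratic form in `b - β̂(r)`. -/
structure Splits (y : ℕ → Fin (T + 1) → ℝ) (X : ℕ → Matrix (Fin T) (Fin K) ℝ) (N : ℕ)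
    (A B C : ℝ) (D : Matrix (Fin K) (Fin K) ℝ) : Prop where
  meanSq_eq : ∀ r b, meanSq y X N r b = quad A B C r
    + (b - betaHat y X N r) ⬝ᵥ (D *ᵥ (b - betaHat y X N r))
  posDef : D.PosDef

variable {y : ℕ → Fin (T + 1) → ℝ} {X : ℕ → Matrix (Fin T) (Fin K) ℝ} {N : ℕ} {A B C : ℝ}
  {D : Matrix (Fin K) (Fin K) ℝ}

lemma Splits.meanSq_betaHat (h : Splits y X N A B C D) (r : ℝ) :
    meanSq y X N r (betaHat y X N r) = quad A B C r := by
  rw [h.meanSq_eq]; simp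

lemma Splits.quad_le (h : Splits y X N A B C D) (r : ℝ) (b : Fin K → ℝ) :
    quad A B C r ≤ meanSq y X N r b := by
  rw [h.meanSq_eq]
  have := h.posDef.posSemidef.dotProduct_mulVec_nonneg (b - betaHat y X N r)
  simp only [star_trivial] at this
  linarith

lemma Splits.hasDerivAt_profLogLik (h : Splits y X N A B C D) (hT : 2 ≤ T) (hA : 0 < A)
    (hAC : B ^ 2 < A * C) (r : ℝ) :
    HasDerivAt (profLogLik y X N) (((T : ℝ) - 1) * (score T A B C r / quad A B C r)) r := by
  have hT1 : (0 : ℝ) < (T : ℝ) - 1 := by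
    have : (2 : ℝ) ≤ T := by exact_mod_cast hT
    linarith
  have hfun : profLogLik y X N = fun r => ((T : ℝ) - 1) * xi T r
      + (-(((T : ℝ) - 1) / 2) * Real.log (((T : ℝ) - 1)⁻¹ * quad A B C r)
        - ((T : ℝ) - 1) / 2) := by
    funext r
    have hq := quad_pos hA hAC r
    unfold profLogLik modLogLik sigma2Hat
    rw [h.meanSq_betaHat]
    field_simp
  have hq := quad_pos hA hAC r
  rw [hfun]
  have h1 := (hasDerivAt_quad A B C r).const_mul ((T : ℝ) - 1)⁻¹
  have h2 := h1.log (by positivity)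
  have h3 := ((hasDerivAt_xi T r).const_mul ((T : ℝ) - 1)).add
    ((h2.const_mul (-(((T : ℝ) - 1) / 2))).sub_const (((T : ℝ) - 1) / 2))
  convert! h3 using 1
  have hq0 := hq.ne'
  have hs : score T A B C r = xiDeriv T r * quad A B C r + B - (r - 1) * C := rfl
  rw [hs]
  field_simp
  ring

lemma differentiable_meanSq : Differentiable ℝ
    (fun η : Param K => meanSq y X N η.1 η.2.2) := by
  unfold meanSq resid dotProduct
  simp only [Matrix.mulVec, dotProduct, Pi.sub_apply, Pi.smul_apply, smul_eq_mul]
  fun_prop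

lemma differentiableAt_modLogLik {θ : Param K} (hθ : 0 < θ.2.1) : DifferentiableAt ℝ
    (fun η : Param K => modLogLik y X N η.1 η.2.1 η.2.2) θ := by
  have hxi : Differentiable ℝ (xi T) := fun x => (hasDerivAt_xi T x).differentiableAt
  have h1 : DifferentiableAt ℝ (fun η : Param K => xi T η.1) θ :=
    (hxi _).comp θ differentiableAt_fst
  have h2 : DifferentiableAt ℝ (fun η : Param K => meanSq y X N η.1 η.2.2) θ :=
    differentiable_meanSq θ
  have h3 : DifferentiableAt ℝ (fun η : Param K => η.2.1) θ := by fun_prop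
  have h4 : DifferentiableAt ℝ (fun η : Param K => 1 / (2 * η.2.1)) θ := by
    simp only [one_div]
    exact (h3.const_mul 2).inv (mul_pos two_pos hθ).ne'
  unfold modLogLik
  exact (h1.const_mul _).add (((h3.log hθ.ne').const_mul _).sub (h4.mul h2))

lemma differentiable_betaHat : Differentiable ℝ (betaHat y X N) := by
  rw [differentiable_pi]
  intro k
  unfold betaHat
  simp only [Matrix.mulVec, dotProduct, Pi.sub_apply, Pi.smul_apply, smul_eq_mul,
    Finset.sum_apply]
  fun_prop

/-- Replacing `b` by `β̂(r)` minimises the sum of squares; optimality of `σ̂²` is then `log t ≤ t -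
1` at `t = σ̂² / s²`. -/
lemma Splits.modLogLik_le (h : Splits y X N A B C D) (hT : 2 ≤ T) (hA : 0 < A)
    (hAC : B ^ 2 < A * C) (r : ℝ) {s2 : ℝ} (hs : 0 < s2) (b : Fin K → ℝ) :
    modLogLik y X N r s2 b ≤ profLogLik y X N r := by
  have hT1 : (0 : ℝ) < (T : ℝ) - 1 := by
    have : (2 : ℝ) ≤ T := by exact_mod_cast hT
    linarith
  have hq := quad_pos hA hAC r
  unfold profLogLik modLogLik sigma2Hat
  rw [h.meanSq_betaHat]
  have h1 : 1 / (2 * s2) * quad A B C r ≤ 1 / (2 * s2) * meanSq y X N r b :=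
    mul_le_mul_of_nonneg_left (h.quad_le r b) (by positivity)
  have h2 : 1 / (2 * (((T : ℝ) - 1)⁻¹ * quad A B C r)) * quad A B C r = ((T : ℝ) - 1) / 2 := by
    field_simp
  have h3 := Real.log_le_sub_one_of_pos
    (by positivity : 0 < (((T : ℝ) - 1)⁻¹ * quad A B C r) / s2)
  rw [Real.log_div (by positivity) hs.ne'] at h3
  have h4 : 1 / (2 * s2) * quad A B C r
      = ((T : ℝ) - 1) / 2 * ((((T : ℝ) - 1)⁻¹ * quad A B C r) / s2) := by
    field_simp
  rw [h2]
  have h5 := mul_le_mul_of_nonneg_left h3 (by positivity : 0 ≤ ((T : ℝ) - 1) / 2)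
  linarith

/-- The profile likelihood has no stationary point in `[-1, ∞)` if its score is positive there. -/
lemma Splits.profMaxima_eq_empty (h : Splits y X N A B C D) (hT : 2 ≤ T) (hA : 0 < A)
    (hAC : B ^ 2 < A * C) (hpos : ∀ x, -1 ≤ x → 0 < score T A B C x) :
    profMaxima y X N = ∅ := by
  have hT1 : (0 : ℝ) < (T : ℝ) - 1 := by
    have : (2 : ℝ) ≤ T := by exact_mod_cast hT
    linarith
  refine Set.eq_empty_of_forall_notMem fun r hr => ?_
  have h1 := hr.2.1.unique (h.hasDerivAt_profLogLik hT hA hAC r)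
  have h2 := hpos r hr.1
  have h3 := quad_pos hA hAC r
  have : 0 < ((T : ℝ) - 1) * (score T A B C r / quad A B C r) := by positivity
  linarith

/-- The joint likelihood has no stationary point with `r ≥ -1` if the profile score is positive
there. -/
lemma Splits.not_stationary (h : Splits y X N A B C D) (hT : 2 ≤ T)
    (hpos : ∀ x, -1 ≤ x → 0 < score T A B C x) {θ : Param K} (hr : -1 ≤ θ.1) (hs : 0 < θ.2.1) :
    ¬ HasFDerivAt (fun η : Param K => modLogLik y X N η.1 η.2.1 η.2.2)
      (0 : Param K →L[ℝ] ℝ) θ := by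
  intro hd
  obtain ⟨r, s2, b⟩ := θ
  simp only at hr hs hd
  have hT1 : (0 : ℝ) < (T : ℝ) - 1 := by
    have : (2 : ℝ) ≤ T := by exact_mod_cast hT
    linarith
  have curve : ∀ (c : ℝ → Param K) (c' : Param K) (t : ℝ), HasDerivAt c c' t → c t = (r, s2, b) →
      HasDerivAt (fun t => modLogLik y X N (c t).1 (c t).2.1 (c t).2.2) 0 t := by
    intro c c' t hc hct
    have := HasFDerivAt.comp_hasDerivAt (f := c) t (by rw [hct]; exact hd) hc
    simpa using! this
  -- the derivative in `s²`
  have e1 : meanSq y X N r b = ((T : ℝ) - 1) * s2 := by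
    have h1 := curve (fun t => (r, t, b)) (0, 1, 0) s2
      ((hasDerivAt_const _ _).prodMk ((hasDerivAt_id _).prodMk (hasDerivAt_const _ _))) rfl
    have h2 : HasDerivAt (fun t => modLogLik y X N r t b)
        (0 + (-(((T : ℝ) - 1) / 2) * s2⁻¹ - (-1 / (2 * s2 ^ 2)) * meanSq y X N r b)) s2 := by
      unfold modLogLik
      refine (hasDerivAt_const _ _).add (((Real.hasDerivAt_log hs.ne').const_mul _).sub
        (HasDerivAt.mul_const ?_ _))
      have := (((hasDerivAt_id s2).const_mul 2).inv (by simp; positivity))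
      simp only [id, mul_one] at this
      convert! this using 1
      · funext t; simp
      · field_simp
    have h3 := h1.unique h2
    field_simp at h3
    linarith
  -- the derivative in `b` along `b - β̂(r)`
  have e2 : b = betaHat y X N r := by
    by_contra hne
    have hne' : b - betaHat y X N r ≠ 0 := sub_ne_zero.2 hne
    set e := b - betaHat y X N r with he
    have h1 := curve (fun t : ℝ => (r, s2, b + t • e)) (0, 0, e) 0
      ((hasDerivAt_const _ _).prodMk ((hasDerivAt_const _ _).prodMk
        (by simpa using! ((hasDerivAt_id (0 : ℝ)).smul_const e).const_add b))) (by simp)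
    have hpd := h.posDef.dotProduct_mulVec_pos hne'
    simp only [star_trivial] at hpd
    have h2 : HasDerivAt (fun t : ℝ => modLogLik y X N r s2 (b + t • e))
        (-(1 / (2 * s2) * (2 * (e ⬝ᵥ (D *ᵥ e))))) 0 := by
      unfold modLogLik
      refine HasDerivAt.const_add _ (HasDerivAt.const_sub _ (HasDerivAt.const_mul _ ?_))
      have hm : (fun t : ℝ => meanSq y X N r (b + t • e))
          = fun t => quad A B C r + (1 + t) ^ 2 * (e ⬝ᵥ (D *ᵥ e)) := by
        funext t
        rw [h.meanSq_eq]
        have : b + t • e - betaHat y X N r = (1 + t) • e := by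
          rw [he]; module
        rw [this, Matrix.mulVec_smul, smul_dotProduct, dotProduct_smul]
        simp only [smul_eq_mul]
        ring
      rw [hm]
      have := ((((hasDerivAt_id (0 : ℝ)).const_add 1).pow 2).mul_const
        (e ⬝ᵥ (D *ᵥ e))).const_add (quad A B C r)
      convert! this using 1
      simp
    have h3 := h1.unique h2
    have : 0 < 1 / (2 * s2) * (2 * (e ⬝ᵥ (D *ᵥ e))) := by positivity
    linarith
  -- the derivative in `r` along `b = β̂(r)`
  rw [e2, h.meanSq_betaHat] at e1
  have h1 := curve (fun t => (t, s2, betaHat y X N t)) (1, 0, deriv (betaHat y X N) r) r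
    ((hasDerivAt_id _).prodMk ((hasDerivAt_const _ _).prodMk
      (differentiable_betaHat r).hasDerivAt)) (by rw [← e2])
  have h2 : HasDerivAt (fun t => modLogLik y X N t s2 (betaHat y X N t))
      (((T : ℝ) - 1) * xiDeriv T r - 1 / (2 * s2) * (-2 * B + 2 * (r - 1) * C)) r := by
    unfold modLogLik
    simp only [h.meanSq_betaHat]
    have := ((hasDerivAt_xi T r).const_mul ((T : ℝ) - 1)).add
      (((hasDerivAt_quad A B C r).const_mul (1 / (2 * s2))).const_sub
        (-(((T : ℝ) - 1) / 2) * Real.log s2))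
    convert! this using 1
  have h3 := h1.unique h2
  have h4 := hpos r hr
  have hsc : score T A B C r = xiDeriv T r * quad A B C r + B - (r - 1) * C := rfl
  -- Stationarity in `s²` and `b` gives `S(r) = (T - 1) s²`, which makes the score equal to `s²`
  -- times the derivative in `r` just shown to be zero.
  rw [hsc, e1] at h4
  field_simp at h3
  nlinarith

/-- A sign change of the profile score on `(0, 1)` produces a local maximum of the profile
likelihood. -/
lemma Splits.exists_profile_max (h : Splits y X N A B C D) (hT : 2 ≤ T) (hA : 0 < A)
    (hAC : B ^ 2 < A * C) (h0 : 0 < score T A B C 0) (h1 : score T A B C 1 < 0) :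
    ∃ r ∈ Set.Ioo (0 : ℝ) 1, IsLocalMax (profLogLik y X N) r := by
  have hT1 : (0 : ℝ) < (T : ℝ) - 1 := by
    have : (2 : ℝ) ≤ T := by exact_mod_cast hT
    linarith
  have hd := h.hasDerivAt_profLogLik hT hA hAC
  set f := profLogLik y X N
  have hcont : ContinuousOn f (Set.Icc 0 1) := fun x _ => (hd x).continuousAt.continuousWithinAt
  obtain ⟨r, hr, hmax⟩ := isCompact_Icc.exists_isMaxOn (Set.nonempty_Icc.2 zero_le_one) hcont
  have hd0 : 0 < ((T : ℝ) - 1) * (score T A B C 0 / quad A B C 0) := by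
    have := quad_pos hA hAC 0
    positivity
  have hd1 : ((T : ℝ) - 1) * (score T A B C 1 / quad A B C 1) < 0 :=
    mul_neg_of_pos_of_neg hT1 (div_neg_of_neg_of_pos h1 (quad_pos hA hAC 1))
  have hr0 : r ≠ 0 := by
    rintro rfl
    -- A maximum over `[0, 1]` at an endpoint would make the derivative in the inward direction
    -- nonpositive, against the sign of the score there.
    have hle := (IsMaxOn.localize hmax).hasFDerivWithinAt_nonpos
      (hd 0).hasFDerivAt.hasFDerivWithinAt (sub_mem_posTangentConeAt_of_segment_subset
        (segment_eq_Icc (zero_le_one' ℝ)).subset)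
    simp at hle
    linarith
  have hr1 : r ≠ 1 := by
    rintro rfl
    have hle := (IsMaxOn.localize hmax).hasFDerivWithinAt_nonpos
      (hd 1).hasFDerivAt.hasFDerivWithinAt (sub_mem_posTangentConeAt_of_segment_subset
        ((segment_symm ℝ (1 : ℝ) 0).trans (segment_eq_Icc (zero_le_one' ℝ))).subset)
    simp at hle
    linarith
  have hIoo : r ∈ Set.Ioo (0 : ℝ) 1 :=
    ⟨lt_of_le_of_ne hr.1 (Ne.symm hr0), lt_of_le_of_ne hr.2 hr1⟩
  exact ⟨r, hIoo, hmax.isLocalMax (Icc_mem_nhds hIoo.1 hIoo.2)⟩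

lemma Splits.profMaxima_nonempty (h : Splits y X N A B C D) (hT : 2 ≤ T) (hA : 0 < A)
    (hAC : B ^ 2 < A * C) (h0 : 0 < score T A B C 0) (h1 : score T A B C 1 < 0) :
    (profMaxima y X N).Nonempty := by
  obtain ⟨r, hr, hmax⟩ := h.exists_profile_max hT hA hAC h0 h1
  have hd := h.hasDerivAt_profLogLik hT hA hAC r
  refine ⟨r, by simp only [Set.mem_Ici]; linarith [hr.1], ?_, hmax.on _⟩
  rwa [hmax.hasDerivAt_eq_zero hd] at hd

/-- The profile likelihood dominates the joint one and equals it at `(r, σ̂², β̂)`, so a local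
maximum of the profile lifts to an unconstrained local maximum of the joint likelihood. -/
lemma Splits.jointMaxima_nonempty (h : Splits y X N A B C D) (hT : 2 ≤ T) (hA : 0 < A)
    (hAC : B ^ 2 < A * C) (h0 : 0 < score T A B C 0) (h1 : score T A B C 1 < 0)
    {S : Set (Param K)} (hS : restrParam K ⊆ S) :
    (jointMaxima S y X N ∩ restrParam K).Nonempty := by
  have hT1 : (0 : ℝ) < (T : ℝ) - 1 := by
    have : (2 : ℝ) ≤ T := by exact_mod_cast hT
    linarith
  obtain ⟨r, hr, hmax⟩ := h.exists_profile_max hT hA hAC h0 h1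
  have hq := quad_pos hA hAC r
  set θ : Param K := (r, sigma2Hat y X N r (betaHat y X N r), betaHat y X N r) with hθ
  have hs : 0 < θ.2.1 := by
    simp only [hθ, sigma2Hat, h.meanSq_betaHat]
    positivity
  have hmem : θ ∈ restrParam K := ⟨by simp only [hθ]; linarith [hr.1], hs⟩
  have hlm : IsLocalMax (fun η : Param K => modLogLik y X N η.1 η.2.1 η.2.2) θ := by
    have c1 : ∀ᶠ η : Param K in 𝓝 θ, profLogLik y X N η.1 ≤ profLogLik y X N r :=
      (continuous_fst.tendsto θ).eventually hmax
    have c2 : ∀ᶠ η : Param K in 𝓝 θ, 0 < η.2.1 :=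
      ((continuous_fst.comp continuous_snd).tendsto θ).eventually (lt_mem_nhds hs)
    filter_upwards [c1, c2] with η h1 h2
    exact (h.modLogLik_le hT hA hAC η.1 h2 η.2.2).trans h1
  refine ⟨θ, ⟨hS hmem, ?_, hlm.on _⟩, hmem⟩
  have := (differentiableAt_modLogLik (y := y) (X := X) (N := N) hs).hasFDerivAt
  rwa [hlm.fderiv_eq_zero] at this

end

/-! ### Within-group algebra of the random walk and concentration over `b` -/

section

variable {T K : ℕ}

/-- The random walk `w_t = ∑_{s < t} e_s`. -/
def walk (e : Fin T → ℝ) : Fin T → ℝ := fun t => ∑ s, if s < t then e s else 0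

lemma lag_eq_walk {yi : Fin (T + 1) → ℝ} {e : Fin T → ℝ}
    (h : ∀ t : Fin T, yi t.succ = yi t.castSucc + e t) (t : Fin T) :
    lag yi t = yi 0 + walk e t := by
  obtain ⟨k, hk⟩ := t
  induction k with
  | zero =>
    have : walk e ⟨0, hk⟩ = 0 := Finset.sum_eq_zero fun s _ => if_neg (by simp [Fin.lt_def])
    rw [this, add_zero]
    rfl
  | succ k ih =>
    have h1 := ih (by omega)
    have h2 := h ⟨k, by omega⟩
    have h3 : walk e ⟨k + 1, hk⟩ = walk e ⟨k, by omega⟩ + e ⟨k, by omega⟩ := by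
      have h4 : e ⟨k, by omega⟩ = ∑ s : Fin T, if s = ⟨k, by omega⟩ then e s else 0 := by simp
      unfold walk
      rw [h4, ← Finset.sum_add_distrib]
      refine Finset.sum_congr rfl fun s _ => ?_
      simp only [Fin.lt_def, Fin.ext_iff]
      rcases lt_trichotomy s.1 k with hs | hs | hs
      · rw [if_pos (by omega), if_pos hs, if_neg (by omega), add_zero]
      · rw [if_pos (by omega), if_neg (by omega), if_pos hs, zero_add]
      · rw [if_neg (by omega), if_neg (by omega), if_neg (by omega), add_zero]
    rw [h3, ← add_assoc, ← h1]
    exact h2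

lemma Q_transpose : (Q T)ᵀ = Q T := by
  ext i j
  simp [Q, Matrix.one_apply, eq_comm]

lemma Q_mul_self (hT : T ≠ 0) : Q T * Q T = Q T := by
  have hT' : (T : ℝ) ≠ 0 := by exact_mod_cast hT
  set J : Matrix (Fin T) (Fin T) ℝ := Matrix.of (fun _ _ => (1 : ℝ)) with hJ
  have hJJ : J * J = (T : ℝ) • J := by
    ext i j
    simp [Matrix.mul_apply, hJ]
  have hQ : Q T = 1 - (T : ℝ)⁻¹ • J := rfl
  rw [hQ]
  simp only [mul_sub, sub_mul, one_mul, mul_one, Matrix.smul_mul, Matrix.mul_smul, hJJ, smul_smul]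
  rw [inv_mul_cancel₀ hT']
  simp

lemma Q_mulVec_const (hT : T ≠ 0) (c : ℝ) : Q T *ᵥ (fun _ => c) = 0 := by
  have hT' : (T : ℝ) ≠ 0 := by exact_mod_cast hT
  ext i
  simp only [Q, Matrix.sub_mulVec, Matrix.one_mulVec, Pi.sub_apply, Pi.zero_apply]
  simp [Matrix.mulVec, dotProduct]
  field_simp
  ring

/-- The bilinear form `u' Q v`. -/
def withinForm (u v : Fin T → ℝ) : ℝ := u ⬝ᵥ (Q T *ᵥ v)

lemma withinForm_eq (u v : Fin T → ℝ) :
    withinForm u v = ∑ t, u t * v t - (T : ℝ)⁻¹ * (∑ t, u t) * ∑ t, v t := by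
  unfold withinForm Q
  rw [Matrix.sub_mulVec, Matrix.one_mulVec, dotProduct_sub]
  congr 1
  simp [Matrix.mulVec, dotProduct, ← Finset.mul_sum, ← Finset.sum_mul]
  ring

lemma withinForm_comm (u v : Fin T → ℝ) : withinForm u v = withinForm v u := by
  rw [withinForm_eq, withinForm_eq]
  simp only [mul_comm (u _)]
  ring

lemma withinForm_add_const (hT : T ≠ 0) (u : Fin T → ℝ) (c : ℝ) :
    withinForm ((fun _ => c) + u) ((fun _ => c) + u) = withinForm u u := by
  have h : ∀ u v : Fin T → ℝ, withinForm u ((fun _ => c) + v) = withinForm u v := by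
    intro u v
    unfold withinForm
    rw [Matrix.mulVec_add, Q_mulVec_const hT, zero_add]
  rw [h, withinForm_comm, h]

/-- `X' Q e`. -/
def crossMoment (Xi : Matrix (Fin T) (Fin K) ℝ) (e : Fin T → ℝ) : Fin K → ℝ := (Xiᵀ * Q T) *ᵥ e

lemma withinForm_mulVec (Xi : Matrix (Fin T) (Fin K) ℝ) (b : Fin K → ℝ) (v : Fin T → ℝ) :
    withinForm (Xi *ᵥ b) v = b ⬝ᵥ crossMoment Xi v := by
  unfold withinForm crossMoment
  rw [← Matrix.vecMul_transpose, ← Matrix.dotProduct_mulVec, Matrix.mulVec_mulVec]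

lemma withinForm_mulVec_mulVec (Xi : Matrix (Fin T) (Fin K) ℝ) (b : Fin K → ℝ) :
    withinForm (Xi *ᵥ b) (Xi *ᵥ b) = b ⬝ᵥ ((Xiᵀ * Q T * Xi) *ᵥ b) := by
  rw [withinForm_mulVec]
  unfold crossMoment
  rw [Matrix.mulVec_mulVec]

lemma withinForm_expand (Xi : Matrix (Fin T) (Fin K) ℝ) (b : Fin K → ℝ) (e w : Fin T → ℝ) (d : ℝ) :
    withinForm (e - d • w - Xi *ᵥ b) (e - d • w - Xi *ᵥ b)
      = withinForm e e - 2 * d * withinForm w e + d ^ 2 * withinForm w w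
        - 2 * (b ⬝ᵥ (crossMoment Xi e - d • crossMoment Xi w))
        + b ⬝ᵥ ((Xiᵀ * Q T * Xi) *ᵥ b) := by
  rw [← withinForm_mulVec_mulVec, dotProduct_sub, dotProduct_smul, ← withinForm_mulVec,
    ← withinForm_mulVec]
  have hs : ∀ u v z : Fin T → ℝ, withinForm (u - v) z = withinForm u z - withinForm v z :=
    fun u v z => sub_dotProduct _ _ _
  have hm : ∀ (c : ℝ) (u z : Fin T → ℝ), withinForm (c • u) z = c * withinForm u z :=
    fun c u z => smul_dotProduct _ _ _
  have hs' : ∀ u v z : Fin T → ℝ, withinForm z (u - v) = withinForm z u - withinForm z v := by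
    intro u v z; rw [withinForm_comm, hs, withinForm_comm u, withinForm_comm v]
  have hm' : ∀ (c : ℝ) (u z : Fin T → ℝ), withinForm z (c • u) = c * withinForm z u := by
    intro c u z; rw [withinForm_comm, hm, withinForm_comm u]
  simp only [hs, hm, hs', hm', smul_eq_mul]
  rw [withinForm_comm e w, withinForm_comm e (Xi *ᵥ b), withinForm_comm w (Xi *ᵥ b)]
  ring

/-- The average of the first `N` terms. -/
def avg (N : ℕ) (f : ℕ → ℝ) : ℝ := (N : ℝ)⁻¹ * ∑ i ∈ Finset.range N, f i

/-- The sample mean of `X_i' Q X_i`. -/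
def gram (N : ℕ) (X : ℕ → Matrix (Fin T) (Fin K) ℝ) : Matrix (Fin K) (Fin K) ℝ :=
  Matrix.of fun k l => avg N fun i => ((X i)ᵀ * Q T * X i) k l

variable {N : ℕ} {y : ℕ → Fin (T + 1) → ℝ} {X : ℕ → Matrix (Fin T) (Fin K) ℝ}
  {e : ℕ → Fin T → ℝ}

lemma sum_gram (hN : N ≠ 0) :
    ∑ i ∈ Finset.range N, (X i)ᵀ * Q T * X i = (N : ℝ) • gram N X := by
  have hN' : (N : ℝ) ≠ 0 := by exact_mod_cast hN
  ext k l
  simp only [Matrix.sum_apply, gram, avg, Matrix.smul_apply, Matrix.of_apply, smul_eq_mul]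
  rw [mul_inv_cancel_left₀ hN']

lemma gram_posSemidef (hT : T ≠ 0) (hN : N ≠ 0) : (gram N X).PosSemidef := by
  have hN' : (0 : ℝ) < N := by exact_mod_cast Nat.pos_of_ne_zero hN
  have h : gram N X = (N : ℝ)⁻¹ • ∑ i ∈ Finset.range N, (X i)ᵀ * Q T * X i := by
    rw [sum_gram hN, smul_smul, inv_mul_cancel₀ hN'.ne', one_smul]
  rw [h]
  refine (Matrix.posSemidef_sum _ fun i _ => ?_).smul (by positivity)
  have : (X i)ᵀ * Q T * X i = (Q T * X i)ᴴ * (Q T * X i) := by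
    rw [Matrix.conjTranspose_eq_transpose_of_trivial, Matrix.transpose_mul, Q_transpose,
      Matrix.mul_assoc, Matrix.mul_assoc, ← Matrix.mul_assoc (Q T) (Q T), Q_mul_self hT]
  rw [this]
  exact Matrix.posSemidef_conjTranspose_mul_self _

/-- The sample mean of `X_i' Q e_i`. -/
def crossAvg (N : ℕ) (X : ℕ → Matrix (Fin T) (Fin K) ℝ) (e : ℕ → Fin T → ℝ) : Fin K → ℝ :=
  fun k => avg N fun i => crossMoment (X i) (e i) k

/-- The initial value enters only through a constant vector, which `Q` annihilates. This matters
because no distributional assumption on `y_{i,0}` itself remains at `ρ = 1`. -/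
lemma lead_sub_smul_lag (h : ∀ i < N, ∀ t : Fin T, y i t.succ = y i t.castSucc + e i t)
    {i : ℕ} (hi : i < N) (r : ℝ) :
    lead (y i) - r • lag (y i)
      = (fun _ => (1 - r) * y i 0) + (e i - (r - 1) • walk (e i)) := by
  ext t
  have h1 := h i hi t
  have h2 := lag_eq_walk (h i hi) t
  simp only [lead, lag, Pi.sub_apply, Pi.add_apply, Pi.smul_apply, smul_eq_mul] at h2 ⊢
  rw [h1, h2]
  ring

lemma betaHat_eq (hT : T ≠ 0) (hN : N ≠ 0)
    (h : ∀ i < N, ∀ t : Fin T, y i t.succ = y i t.castSucc + e i t) (hD : IsUnit (gram N X).det)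
    (r : ℝ) :
    betaHat y X N r = (gram N X)⁻¹ *ᵥ
      (crossAvg N X e - (r - 1) • crossAvg N X fun i => walk (e i)) := by
  have hN' : (N : ℝ) ≠ 0 := by exact_mod_cast hN
  have hsum : ∑ i ∈ Finset.range N, ((X i)ᵀ * Q T) *ᵥ (lead (y i) - r • lag (y i))
      = (N : ℝ) • (crossAvg N X e - (r - 1) • crossAvg N X fun i => walk (e i)) := by
    have h1 : ∀ i ∈ Finset.range N, ((X i)ᵀ * Q T) *ᵥ (lead (y i) - r • lag (y i))
        = crossMoment (X i) (e i) - (r - 1) • crossMoment (X i) (walk (e i)) := by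
      intro i hi
      rw [lead_sub_smul_lag h (Finset.mem_range.1 hi), Matrix.mulVec_add, ← Matrix.mulVec_mulVec,
        Q_mulVec_const hT, Matrix.mulVec_zero, zero_add, Matrix.mulVec_sub, Matrix.mulVec_smul]
      rfl
    rw [Finset.sum_congr rfl h1]
    ext k
    simp only [Finset.sum_apply, Pi.sub_apply, Pi.smul_apply, smul_eq_mul, crossAvg, avg,
      Finset.sum_sub_distrib, ← Finset.mul_sum]
    field_simp
  have hinv : ((N : ℝ) • gram N X)⁻¹ = (N : ℝ)⁻¹ • (gram N X)⁻¹ := by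
    refine Matrix.inv_eq_left_inv ?_
    rw [Matrix.smul_mul, Matrix.mul_smul, Matrix.nonsing_inv_mul _ hD, smul_smul,
      inv_mul_cancel₀ hN', one_smul]
  unfold betaHat
  rw [sum_gram hN, hsum, hinv, Matrix.mulVec_smul, Matrix.smul_mulVec, smul_smul,
    mul_inv_cancel₀ hN', one_smul]

/-- Completing the square in `b`: each coefficient is a raw error moment minus the part explained by
the covariates, and `gram` is positive definite because it is positive semidefinite and invertible.
-/
lemma splits_of_eqn (hT : T ≠ 0) (hN : N ≠ 0)
    (h : ∀ i < N, ∀ t : Fin T, y i t.succ = y i t.castSucc + e i t)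
    (hD : IsUnit (gram N X).det) :
    Splits y X N
      ((avg N fun i => withinForm (e i) (e i))
        - crossAvg N X e ⬝ᵥ ((gram N X)⁻¹ *ᵥ crossAvg N X e))
      ((avg N fun i => withinForm (walk (e i)) (e i))
        - crossAvg N X e ⬝ᵥ ((gram N X)⁻¹ *ᵥ crossAvg N X fun i => walk (e i)))
      ((avg N fun i => withinForm (walk (e i)) (walk (e i)))
        - (crossAvg N X fun i => walk (e i)) ⬝ᵥ
          ((gram N X)⁻¹ *ᵥ crossAvg N X fun i => walk (e i)))
      (gram N X) := by
  have hpsd := gram_posSemidef (X := X) hT hN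
  have hsymm : (gram N X)ᵀ = gram N X := hpsd.1
  refine ⟨fun r b => ?_, ?_⟩
  · set p := crossAvg N X e with hp
    set q := crossAvg N X fun i => walk (e i) with hq
    set D := gram N X with hDdef
    have hm : meanSq y X N r b = (avg N fun i => withinForm (e i) (e i))
        - 2 * (r - 1) * (avg N fun i => withinForm (walk (e i)) (e i))
        + (r - 1) ^ 2 * (avg N fun i => withinForm (walk (e i)) (walk (e i)))
        - 2 * (b ⬝ᵥ (p - (r - 1) • q)) + b ⬝ᵥ (D *ᵥ b) := by
      have h1 : ∀ i ∈ Finset.range N,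
          resid (y i) (X i) r b ⬝ᵥ (Q T *ᵥ resid (y i) (X i) r b)
          = withinForm (e i) (e i) - 2 * (r - 1) * withinForm (walk (e i)) (e i)
            + (r - 1) ^ 2 * withinForm (walk (e i)) (walk (e i))
            - 2 * (b ⬝ᵥ (crossMoment (X i) (e i) - (r - 1) • crossMoment (X i) (walk (e i))))
            + b ⬝ᵥ (((X i)ᵀ * Q T * X i) *ᵥ b) := by
        intro i hi
        rw [← withinForm_expand]
        unfold resid
        rw [lead_sub_smul_lag h (Finset.mem_range.1 hi), add_sub_assoc]
        exact withinForm_add_const hT _ _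
      have hp' : ∀ v : ℕ → Fin T → ℝ, b ⬝ᵥ crossAvg N X v
          = (N : ℝ)⁻¹ * ∑ i ∈ Finset.range N, b ⬝ᵥ crossMoment (X i) (v i) := by
        intro v
        simp only [crossAvg, avg, dotProduct]
        rw [Finset.sum_comm, Finset.mul_sum]
        refine Finset.sum_congr rfl fun k _ => ?_
        rw [← Finset.mul_sum]
        ring
      have hD' : b ⬝ᵥ (D *ᵥ b)
          = (N : ℝ)⁻¹ * ∑ i ∈ Finset.range N, b ⬝ᵥ (((X i)ᵀ * Q T * X i) *ᵥ b) := by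
        have hN' : (N : ℝ) ≠ 0 := by exact_mod_cast hN
        rw [← dotProduct_sum, ← Matrix.sum_mulVec, sum_gram hN, Matrix.smul_mulVec,
          dotProduct_smul, smul_eq_mul, inv_mul_cancel_left₀ hN']
      rw [dotProduct_sub, dotProduct_smul, hp, hq, hp', hp', hD']
      unfold meanSq
      rw [Finset.sum_congr rfl h1]
      simp only [dotProduct_sub, dotProduct_smul, smul_eq_mul, avg, Finset.sum_add_distrib,
        Finset.sum_sub_distrib, ← Finset.mul_sum]
      ring
    rw [hm, betaHat_eq hT hN h hD r, ← hp, ← hq, ← hDdef]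
    have hcancel : ∀ v, D *ᵥ (D⁻¹ *ᵥ v) = v := fun v => by
      rw [Matrix.mulVec_mulVec, Matrix.mul_nonsing_inv _ hD, Matrix.one_mulVec]
    have hsymD : ∀ u v, u ⬝ᵥ (D *ᵥ v) = v ⬝ᵥ (D *ᵥ u) := fun u v => by
      rw [Matrix.dotProduct_mulVec, ← Matrix.mulVec_transpose, hsymm, dotProduct_comm]
    have hsymI : ∀ u v, u ⬝ᵥ (D⁻¹ *ᵥ v) = v ⬝ᵥ (D⁻¹ *ᵥ u) := fun u v => by
      rw [Matrix.dotProduct_mulVec, ← Matrix.mulVec_transpose, Matrix.transpose_nonsing_inv, hsymm,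
        dotProduct_comm]
    set c := p - (r - 1) • q with hc
    have h1 : ∀ c, (b - D⁻¹ *ᵥ c) ⬝ᵥ (D *ᵥ (b - D⁻¹ *ᵥ c))
        = b ⬝ᵥ (D *ᵥ b) - 2 * (b ⬝ᵥ c) + c ⬝ᵥ (D⁻¹ *ᵥ c) := by
      intro c
      rw [Matrix.mulVec_sub, hcancel, sub_dotProduct, dotProduct_sub, dotProduct_sub,
        hsymD (D⁻¹ *ᵥ c) b, hcancel, dotProduct_comm (D⁻¹ *ᵥ c) c]
      ring
    have h2 : c ⬝ᵥ (D⁻¹ *ᵥ c) = p ⬝ᵥ (D⁻¹ *ᵥ p) - 2 * (r - 1) * (p ⬝ᵥ (D⁻¹ *ᵥ q))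
        + (r - 1) ^ 2 * (q ⬝ᵥ (D⁻¹ *ᵥ q)) := by
      rw [hc, Matrix.mulVec_sub, Matrix.mulVec_smul, sub_dotProduct, dotProduct_sub,
        dotProduct_sub, smul_dotProduct, smul_dotProduct, dotProduct_smul, dotProduct_smul,
        hsymI q p]
      simp only [smul_eq_mul]
      ring
    rw [h1, h2]
    unfold quad
    ring
  · refine hpsd.posDef_iff_isUnit.2 ?_
    exact (Matrix.isUnit_iff_isUnit_det _).2 hD

/-- This makes the covariate corrections to `A`, `B`, `C` quadratic in the cross moments, hence of
second order. -/
lemma abs_dotProduct_mulVec_le {u v : Fin K → ℝ} {M : Matrix (Fin K) (Fin K) ℝ} {m C : ℝ}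
    (hu : ∀ k, |u k| ≤ m) (hv : ∀ k, |v k| ≤ m) (hM : ∀ k l, |M k l| ≤ C) (hm : 0 ≤ m) :
    |u ⬝ᵥ (M *ᵥ v)| ≤ K ^ 2 * C * m ^ 2 := by
  have h1 : u ⬝ᵥ (M *ᵥ v) = ∑ k, ∑ l, u k * (M k l * v l) := by
    simp only [dotProduct, Matrix.mulVec, Finset.mul_sum]
  have h2 : ∀ k l, |u k * (M k l * v l)| ≤ m * (C * m) := by
    intro k l
    rw [abs_mul, abs_mul]
    have hC : 0 ≤ C := (abs_nonneg _).trans (hM k l)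
    exact mul_le_mul (hu k) (mul_le_mul (hM k l) (hv l) (abs_nonneg _) hC) (by positivity) hm
  rw [h1]
  calc |∑ k, ∑ l, u k * (M k l * v l)| ≤ ∑ k : Fin K, ∑ l : Fin K, m * (C * m) := by
        refine (Finset.abs_sum_le_sum_abs _ _).trans (Finset.sum_le_sum fun k _ => ?_)
        exact (Finset.abs_sum_le_sum_abs _ _).trans (Finset.sum_le_sum fun l _ => h2 k l)
    _ = K ^ 2 * C * m ^ 2 := by simp; ring

/-- The sample moments are within `u` of their population values, and the inverse of the sample
mean of `X_i' Q X_i` is bounded by `M`. -/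
structure MomentsNear (s M u : ℝ) (N : ℕ) (X : ℕ → Matrix (Fin T) (Fin K) ℝ)
    (e : ℕ → Fin T → ℝ) : Prop where
  errSq : |(avg N fun i => withinForm (e i) (e i)) - s * ((T : ℝ) - 1)| ≤ u
  walkErr : |(avg N fun i => withinForm (walk (e i)) (e i)) + s * ((T : ℝ) - 1) / 2| ≤ u
  walkSq : |(avg N fun i => withinForm (walk (e i)) (walk (e i)))
    - s * ((T : ℝ) - 1) * (((T : ℝ) + 1) / 6)| ≤ u
  crossErr : ∀ k, |crossAvg N X e k| ≤ u
  crossWalk : ∀ k, |crossAvg N X (fun i => walk (e i)) k| ≤ u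
  isUnit : IsUnit (gram N X).det
  inv_le : ∀ k l, |(gram N X)⁻¹ k l| ≤ M

/-- The sample mean of `e_i' Q e_i / 2 + w_i' Q e_i`, the leading term of the profile score at
`r = 1`. -/
def scoreAvg (N : ℕ) (e : ℕ → Fin T → ℝ) : ℝ :=
  avg N fun i => withinForm (e i) (e i) / 2 + withinForm (walk (e i)) (e i)

/-- Near the population moments, the sign of the leading term of the score at `r = 1` decides
between the absence of stationary points and an interior local maximum. -/
lemma exists_score_threshold (hT : 2 ≤ T) {s M : ℝ} (hs : 0 < s) (hM : 0 ≤ M) :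
    ∃ L u₀ : ℝ, 0 < L ∧ 0 < u₀ ∧ ∀ (u : ℝ) (N : ℕ) (y : ℕ → Fin (T + 1) → ℝ)
      (X : ℕ → Matrix (Fin T) (Fin K) ℝ) (e : ℕ → Fin T → ℝ), 0 ≤ u → u ≤ u₀ → N ≠ 0 →
      (∀ i < N, ∀ t : Fin T, y i t.succ = y i t.castSucc + e i t) → MomentsNear s M u N X e →
      ∃ A B C D, Splits y X N A B C D ∧ 0 < A ∧ B ^ 2 < A * C ∧ 0 < score T A B C 0 ∧
        (L * u ^ 2 < scoreAvg N e → ∀ x, -1 ≤ x → 0 < score T A B C x) ∧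
        (scoreAvg N e < -(L * u ^ 2) → score T A B C 1 < 0) := by
  obtain ⟨n, rfl⟩ : ∃ n, T = n + 2 := ⟨T - 2, by omega⟩
  set R : ℝ := K ^ 2 * M with hR
  have hR0 : 0 ≤ R := by positivity
  -- For `u ≤ 1` the corrections are at most `R u ^ 2 ≤ R u`, so the coefficients are within `m = (1
  -- + R) u` of their limits. The first summand is the threshold of `NearLimit.score_pos` at this
  -- `m`; the second bounds the gap between `A / 2 + B` and `scoreAvg`.
  refine ⟨8 * 2 ^ n * (n + 2) ^ 3 / s * (1 + R) ^ 2 + 3 / 2 * R,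
    min 1 (s / (32 * (n + 2) ^ 2) / (1 + R)), by positivity, by positivity,
    fun u N y X e hu hu0 hN h hnear => ?_⟩
  have hu1 : u ≤ 1 := hu0.trans (min_le_left _ _)
  have hu2 : (1 + R) * u ≤ s / (32 * (n + 2) ^ 2) := by
    have := hu0.trans (min_le_right _ _)
    rw [le_div_iff₀ (by positivity)] at this
    linarith
  have hpp := abs_dotProduct_mulVec_le hnear.crossErr hnear.crossErr hnear.inv_le hu
  have hpq := abs_dotProduct_mulVec_le hnear.crossErr hnear.crossWalk hnear.inv_le hu
  have hqq := abs_dotProduct_mulVec_le hnear.crossWalk hnear.crossWalk hnear.inv_le hu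
  rw [← hR] at hpp hpq hqq
  have hsplit := splits_of_eqn (by omega) hN h hnear.isUnit
  set A := (avg N fun i => withinForm (e i) (e i))
        - crossAvg N X e ⬝ᵥ ((gram N X)⁻¹ *ᵥ crossAvg N X e) with hA
  set B := (avg N fun i => withinForm (walk (e i)) (e i))
        - crossAvg N X e ⬝ᵥ ((gram N X)⁻¹ *ᵥ crossAvg N X fun i => walk (e i)) with hB
  set C := (avg N fun i => withinForm (walk (e i)) (walk (e i)))
        - (crossAvg N X fun i => walk (e i)) ⬝ᵥ
          ((gram N X)⁻¹ *ᵥ crossAvg N X fun i => walk (e i)) with hC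
  have hRu : R * u ^ 2 ≤ R * u := by
    have : u ^ 2 ≤ u := by nlinarith
    exact mul_le_mul_of_nonneg_left this hR0
  have g1 := abs_le.1 hpp
  have g2 := abs_le.1 hpq
  have g3 := abs_le.1 hqq
  have near : NearLimit n s ((1 + R) * u) A B C := by
    have f1 := abs_le.1 hnear.errSq
    have f2 := abs_le.1 hnear.walkErr
    have f3 := abs_le.1 hnear.walkSq
    push_cast at f1 f2 f3
    refine ⟨abs_le.2 ⟨?_, ?_⟩, abs_le.2 ⟨?_, ?_⟩, abs_le.2 ⟨?_, ?_⟩⟩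
    · linarith [f1.1, g1.2]
    · linarith [f1.2, g1.1]
    · linarith [f2.1, g2.2]
    · linarith [f2.2, g2.1]
    · linarith [f3.1, g3.2]
    · linarith [f3.2, g3.1]
  have hpos := near.pos hs hu2
  have hav : scoreAvg N e = (avg N fun i => withinForm (e i) (e i)) / 2
      + avg N fun i => withinForm (walk (e i)) (e i) := by
    unfold scoreAvg avg
    rw [Finset.sum_add_distrib, ← Finset.sum_div]
    ring
  refine ⟨A, B, C, gram N X, hsplit, hpos.1, hpos.2, near.score_zero_pos hs (by positivity) hu2,
    fun hZ x hx => near.score_pos hs hx (by positivity) hu2 ?_, fun hZ => ?_⟩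
  · rw [hav] at hZ
    have : 8 * 2 ^ n * ((n : ℝ) + 2) ^ 3 / s * ((1 + R) * u) ^ 2
        = 8 * 2 ^ n * (n + 2) ^ 3 / s * (1 + R) ^ 2 * u ^ 2 := by ring
    rw [this]
    linarith [g1.2, g2.2]
  · rw [hav] at hZ
    have h1 : score (n + 2) A B C 1 = A / 2 + B := by
      unfold score; rw [xiDeriv_one]; ring
    have : 0 ≤ 8 * 2 ^ n * ((n : ℝ) + 2) ^ 3 / s * (1 + R) ^ 2 * u ^ 2 := by positivity
    rw [h1]
    linarith [g1.1, g2.1]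

end

/-! ### Negligible events, Chebyshev bounds and the weak law -/

section

variable {Ω : Type*} [MeasurableSpace Ω] {P : Measure Ω}

/-- A sequence of sets whose outer probabilities vanish in the limit. -/
def Negligible (P : Measure Ω) (B : ℕ → Set Ω) : Prop := Tendsto (fun N => P (B N)) atTop (𝓝 0)

lemma Negligible.mono {B C : ℕ → Set Ω} (h : Negligible P C) (hBC : ∀ N, B N ⊆ C N) :
    Negligible P B :=
  tendsto_of_tendsto_of_tendsto_of_le_of_le tendsto_const_nhds h (fun _ => zero_le)
    fun N => measure_mono (hBC N)

lemma Negligible.union {B C : ℕ → Set Ω} (hB : Negligible P B) (hC : Negligible P C) :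
    Negligible P fun N => B N ∪ C N := by
  have := Tendsto.add hB hC
  rw [add_zero] at this
  exact tendsto_of_tendsto_of_tendsto_of_le_of_le tendsto_const_nhds this (fun _ => zero_le)
    fun N => measure_union_le _ _

lemma Negligible.iUnion {ι : Type*} [Fintype ι] {B : ι → ℕ → Set Ω}
    (h : ∀ k, Negligible P (B k)) : Negligible P fun N => ⋃ k, B k N := by
  have := tendsto_finsetSum Finset.univ fun k _ => h k
  rw [Finset.sum_const_zero] at this
  exact tendsto_of_tendsto_of_tendsto_of_le_of_le tendsto_const_nhds this (fun _ => zero_le)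
    fun N => measure_iUnion_fintype_le _ _

lemma negligible_of_eventually_empty {B : ℕ → Set Ω} (h : ∀ᶠ N in atTop, B N = ∅) :
    Negligible P B := by
  refine tendsto_const_nhds.congr' ?_
  filter_upwards [h] with N hN
  rw [hN, measure_empty]

lemma negligible_of_null {B : Set Ω} (h : P B = 0) : Negligible P fun _ => B := by
  unfold Negligible
  simp only [h]
  exact tendsto_const_nhds

/-- The bandwidth `√(τ / √N)`, which is of larger order than `N ^ (-1/2)` in mean square. -/
def band (τ : ℝ) (N : ℕ) : ℝ := √(τ / √N)

lemma band_sq {τ : ℝ} (hτ : 0 ≤ τ) (N : ℕ) : band τ N ^ 2 = τ / √N := by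
  unfold band
  exact Real.sq_sqrt (by positivity)

lemma tendsto_band (τ : ℝ) : Tendsto (band τ) atTop (𝓝 0) := by
  have h1 : Tendsto (fun N : ℕ => √(N : ℝ)) atTop atTop :=
    Real.tendsto_sqrt_atTop.comp tendsto_natCast_atTop_atTop
  have h2 : Tendsto (fun N : ℕ => τ / √(N : ℝ)) atTop (𝓝 0) := h1.const_div_atTop τ
  have := (Real.continuous_sqrt.tendsto 0).comp h2
  rw [Real.sqrt_zero] at this
  exact this

lemma aemeasurable_avg {U : ℕ → Ω → ℝ} (h : ∀ i, AEMeasurable (U i) P) (N : ℕ) :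
    AEMeasurable (fun ω => avg N fun i => U i ω) P :=
  (Finset.aemeasurable_fun_sum _ fun i _ => h i).const_mul _

/-- Averages of i.i.d. square integrable variables are within `√(τ / √N)` of their mean with
probability tending to one. -/
lemma negligible_avg_sub [IsProbabilityMeasure P] {U : ℕ → Ω → ℝ} (hindep : iIndepFun U P)
    (hident : ∀ i, IdentDistrib (U i) (U 0) P P) (hU : MemLp (U 0) 2 P) {m : ℝ}
    (hm : ∫ ω, U 0 ω ∂P = m) {τ : ℝ} (hτ : 0 < τ) :
    Negligible P fun N => {ω | band τ N < |(avg N fun i => U i ω) - m|} := by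
  have hUi : ∀ i, MemLp (U i) 2 P := fun i => (hident i).memLp_iff.2 hU
  -- Chebyshev's bound at the bandwidth is `(Var / N) / (τ / √N)`.
  have hlim : Tendsto (fun N : ℕ => ENNReal.ofReal (Var[U 0; P] / τ / √N)) atTop (𝓝 0) := by
    have h1 : Tendsto (fun N : ℕ => √(N : ℝ)) atTop atTop :=
      Real.tendsto_sqrt_atTop.comp tendsto_natCast_atTop_atTop
    simpa using ENNReal.tendsto_ofReal (h1.const_div_atTop (Var[U 0; P] / τ))
  refine tendsto_of_tendsto_of_tendsto_of_le_of_le' tendsto_const_nhds hlim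
    (Eventually.of_forall fun _ => zero_le) ?_
  filter_upwards [eventually_ne_atTop 0] with N hN
  have hN' : (0 : ℝ) < N := by exact_mod_cast Nat.pos_of_ne_zero hN
  have hS : MemLp (∑ i ∈ Finset.range N, U i) 2 P := memLp_finsetSum' _ fun i _ => hUi i
  have hA : MemLp (fun ω => avg N fun i => U i ω) 2 P := by
    have := hS.const_mul (N : ℝ)⁻¹
    refine this.congr_norm (this.1.congr (ae_of_all _ fun ω => ?_)) (ae_of_all _ fun ω => ?_) <;>
    simp [avg]
  have hmean : ∫ ω, (avg N fun i => U i ω) ∂P = m := by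
    unfold avg
    rw [integral_const_mul, integral_finsetSum _ fun i _ => (hUi i).integrable (by norm_num)]
    simp only [(hident _).integral_eq, hm]
    simp [hN'.ne']
  have hvar : Var[fun ω => avg N fun i => U i ω; P] = Var[U 0; P] / N := by
    have h1 : (fun ω => avg N fun i => U i ω)
        = fun ω => (N : ℝ)⁻¹ * (∑ i ∈ Finset.range N, U i) ω := by
      funext ω; simp [avg]
    rw [h1, variance_const_mul, IndepFun.variance_sum (fun i _ => hUi i)
      (fun i _ j _ hij => hindep.indepFun hij)]
    simp only [(hident _).variance_eq]
    simp
    field_simp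
  have hpos : 0 < band τ N := Real.sqrt_pos.2 (by positivity)
  have hcheb := meas_ge_le_variance_div_sq hA hpos
  rw [hmean, hvar, band_sq hτ.le] at hcheb
  refine (measure_mono fun ω hω => ?_).trans (hcheb.trans (le_of_eq ?_))
  · simp only [Set.mem_ofPred_eq] at hω ⊢
    exact hω.le
  · congr 1
    have h3 : 0 < √(N : ℝ) := Real.sqrt_pos.2 hN'
    field_simp
    rw [Real.sq_sqrt hN'.le]

/-- Weak law of large numbers for i.i.d. integrable variables. -/
lemma negligible_avg_sub_const [IsProbabilityMeasure P] {U : ℕ → Ω → ℝ} (hindep : iIndepFun U P)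
    (hident : ∀ i, IdentDistrib (U i) (U 0) P P) (hU : Integrable (U 0) P)
    {δ : ℝ} (hδ : 0 < δ) :
    Negligible P fun N => {ω | δ ≤ |(avg N fun i => U i ω) - ∫ ω, U 0 ω ∂P|} := by
  have h1 := strong_law_ae_real U hU (fun i j hij => hindep.indepFun hij) hident
  have h2 : TendstoInMeasure P (fun N ω => avg N fun i => U i ω) atTop
      (fun _ => ∫ ω, U 0 ω ∂P) := by
    refine tendstoInMeasure_of_tendsto_ae
      (fun N => (aemeasurable_avg (fun i => (hident i).aemeasurable_fst) N).aestronglyMeasurable)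
      ?_
    filter_upwards [h1] with ω hω
    refine hω.congr fun N => ?_
    rw [avg, div_eq_inv_mul]
  have h3 := tendstoInMeasure_iff_dist.1 h2 δ hδ
  exact h3

/-! ### Normal limits and convergence of sandwiched events -/

section Gaussian

variable {v : NNReal}

lemma gaussianReal_Ioi_pos (hv : v ≠ 0) (x : ℝ) : 0 < gaussianReal 0 v (Set.Ioi x) := by
  rw [pos_iff_ne_zero]
  intro h
  have := gaussianReal_absolutelyContinuous' 0 hv h
  simp at this

lemma gaussianReal_singleton (hv : v ≠ 0) (x : ℝ) : gaussianReal 0 v {x} = 0 :=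
  gaussianReal_absolutelyContinuous 0 hv (by simp)

/-- The central limit theorem for the tails of normalised sums. -/
lemma tendsto_measure_sqrt_mul_avg [IsProbabilityMeasure P] {U : ℕ → Ω → ℝ}
    (hindep : iIndepFun U P) (hident : ∀ i, IdentDistrib (U i) (U 0) P P)
    (hU : MemLp (U 0) 2 P) (hm : ∫ ω, U 0 ω ∂P = 0) (hv : Var[U 0; P].toNNReal ≠ 0)
    {E : Set ℝ} (hE : MeasurableSet E) {x : ℝ} (hfr : frontier E ⊆ {x}) :
    Tendsto (fun N : ℕ => P {ω | √N * (avg N fun i => U i ω) ∈ E}) atTop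
      (𝓝 (gaussianReal 0 Var[U 0; P].toNNReal E)) := by
  have hlaw : HasLaw (fun x : ℝ => x) (gaussianReal 0 Var[U 0; P].toNNReal)
      (gaussianReal 0 Var[U 0; P].toNNReal) := ⟨aemeasurable_id, Measure.map_id⟩
  have hclt := tendstoInDistribution_inv_sqrt_mul_sum_sub hlaw hU hindep hident
  have key := ProbabilityMeasure.tendsto_measure_of_null_frontier_of_tendsto' hclt.tendsto
    (E := E) (by
      simp only [ProbabilityMeasure.coe_mk]
      rw [hlaw.map_eq]
      exact measure_mono_null hfr (gaussianReal_singleton hv x))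
  simp only [ProbabilityMeasure.coe_mk] at key
  rw [hlaw.map_eq] at key
  refine key.congr fun N => ?_
  rw [Measure.map_apply_of_aemeasurable (hclt.forall_aemeasurable N) hE]
  congr 1
  ext ω
  simp only [Set.mem_preimage, Set.mem_ofPred_eq]
  rw [hm]
  have : (√(N : ℝ))⁻¹ * (∑ k ∈ Finset.range N, U k ω - N * 0) = √N * avg N fun i => U i ω := by
    unfold avg
    rw [mul_zero, sub_zero, ← mul_assoc]
    congr 1
    rcases Nat.eq_zero_or_pos N with rfl | hN
    · simp
    · have h2 : √(N : ℝ) * √(N : ℝ) = N := Real.mul_self_sqrt (by positivity)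
      have h3 : 0 < √(N : ℝ) := Real.sqrt_pos.2 (by exact_mod_cast hN)
      field_simp
      linarith
  rw [this]

/-- If the events `E N` agree with `{s N > 0}` up to arbitrarily small shifts of the threshold and
negligible events, and the tails of `s N` converge to those of a normal law, then the
probabilities of `E N` converge. -/
lemma tendsto_measure_of_sandwich {s : ℕ → Ω → ℝ} (hv : v ≠ 0)
    (hopen : ∀ x, Tendsto (fun N => P {ω | s N ω ∈ Set.Ioi x}) atTop
      (𝓝 (gaussianReal 0 v (Set.Ioi x))))
    (hclosed : ∀ x, Tendsto (fun N => P {ω | s N ω ∈ Set.Ici x}) atTop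
      (𝓝 (gaussianReal 0 v (Set.Ici x))))
    {E : ℕ → Set Ω} (hlow : ∀ x, 0 < x → Negligible P fun N => {ω | s N ω ∈ Set.Ioi x} \ E N)
    (hupp : ∀ x, x < 0 → Negligible P fun N => E N \ {ω | s N ω ∈ Set.Ici x}) :
    Tendsto (fun N => P (E N)) atTop (𝓝 (gaussianReal 0 v (Set.Ioi 0))) := by
  have hinv : ∀ n : ℕ, (0 : ℝ) < 1 / (n + 1) := fun n => by positivity
  have hanti : Antitone fun n : ℕ => (1 : ℝ) / (n + 1) := fun m n h => by
    apply one_div_le_one_div_of_le (by positivity)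
    have : (m : ℝ) ≤ n := by exact_mod_cast h
    linarith
  have ht : Tendsto (fun n : ℕ => (1 : ℝ) / (n + 1)) atTop (𝓝 0) :=
    tendsto_one_div_add_atTop_nhds_zero_nat
  refine tendsto_order.2 ⟨fun a ha => ?_, fun a ha => ?_⟩
  -- Continuity from below gives a positive threshold beyond which the normal law still has mass
  -- above `a`.
  · have hU : (⋃ n : ℕ, Set.Ioi ((1 : ℝ) / (n + 1))) = Set.Ioi 0 := by
      ext z
      simp only [Set.mem_iUnion, Set.mem_Ioi]
      constructor
      · rintro ⟨n, hn⟩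
        exact (hinv n).trans hn
      · intro hz
        exact (ht.eventually (gt_mem_nhds hz)).exists
    have h1 := tendsto_measure_iUnion_atTop (μ := gaussianReal 0 v)
      (s := fun n : ℕ => Set.Ioi ((1 : ℝ) / (n + 1)))
      (fun m n h => Set.Ioi_subset_Ioi (hanti h))
    rw [hU] at h1
    obtain ⟨n, hn⟩ := (h1.eventually (lt_mem_nhds ha)).exists
    have h2 := ENNReal.Tendsto.sub (hopen (1 / ((n : ℝ) + 1))) (hlow _ (hinv n))
      (Or.inr ENNReal.zero_ne_top)
    rw [tsub_zero] at h2
    filter_upwards [h2.eventually (lt_mem_nhds hn)] with N hN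
    -- Only monotonicity and subadditivity are used, so `E N` need not be measurable.
    refine hN.trans_le (tsub_le_iff_right.2 ?_)
    refine (measure_mono ?_).trans (measure_union_le _ _)
    intro ω hω
    by_cases h : ω ∈ E N
    · exact Or.inl h
    · exact Or.inr ⟨hω, h⟩
  · have hI : (⋂ n : ℕ, Set.Ici (-((1 : ℝ) / (n + 1)))) = Set.Ici 0 := by
      ext z
      simp only [Set.mem_iInter, Set.mem_Ici]
      constructor
      · intro h
        have := ge_of_tendsto' (b := -z) ht fun n => by linarith [h n]
        linarith
      · intro hz n
        linarith [hinv n]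
    have h1 := tendsto_measure_iInter_atTop (μ := gaussianReal 0 v)
      (s := fun n : ℕ => Set.Ici (-((1 : ℝ) / (n + 1))))
      (fun n => measurableSet_Ici.nullMeasurableSet)
      (fun m n h => Set.Ici_subset_Ici.2 (neg_le_neg (hanti h))) ⟨0, measure_ne_top _ _⟩
    -- The normal law has no atom at `0`, so the upper and lower limits agree.
    have h0 : gaussianReal 0 v (Set.Ici 0) = gaussianReal 0 v (Set.Ioi 0) := by
      refine le_antisymm ?_ (measure_mono Set.Ioi_subset_Ici_self)
      rw [← Set.Ioi_union_left]
      refine (measure_union_le _ _).trans (le_of_eq ?_)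
      rw [gaussianReal_singleton hv, add_zero]
    rw [hI, h0] at h1
    obtain ⟨n, hn⟩ := (h1.eventually (gt_mem_nhds ha)).exists
    have h2 := (hclosed (-(1 / ((n : ℝ) + 1)))).add (hupp _ (neg_lt_zero.2 (hinv n)))
    rw [add_zero] at h2
    filter_upwards [h2.eventually (gt_mem_nhds hn)] with N hN
    refine lt_of_le_of_lt ((measure_mono ?_).trans (measure_union_le _ _)) hN
    intro ω hω
    by_cases h : ω ∈ {ω | s N ω ∈ Set.Ici (-(1 / ((n : ℝ) + 1)))}
    · exact Or.inl h
    · exact Or.inr ⟨hω, h⟩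

end Gaussian

end

/-! ### Moments of quadratic forms in the errors -/

section

variable {Ω : Type*} [MeasurableSpace Ω] {P : Measure Ω} {T K : ℕ}

/-- The strictly lower triangular matrix of ones. -/
def walkMatrix (T : ℕ) : Matrix (Fin T) (Fin T) ℝ := Matrix.of fun t s => if s < t then 1 else 0

lemma walk_eq_mulVec (e : Fin T → ℝ) : walk e = walkMatrix T *ᵥ e := by
  ext t
  simp [walk, walkMatrix, Matrix.mulVec, dotProduct]

lemma sum_walk (e : Fin T → ℝ) : ∑ t, walk e t = ∑ s : Fin T, ((T : ℝ) - 1 - s) * e s := by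
  unfold walk
  rw [Finset.sum_comm]
  refine Finset.sum_congr rfl fun s _ => ?_
  rw [← Finset.sum_filter, Finset.sum_const, nsmul_eq_mul]
  have : (Finset.univ.filter fun t : Fin T => s < t) = Finset.Ioi s := by ext t; simp
  rw [this, Fin.card_Ioi]
  congr 1
  have := s.2
  rw [Nat.cast_sub (by omega), Nat.cast_sub (by omega)]
  simp

lemma sum_walk_mul (e : Fin T → ℝ) :
    2 * ∑ t, walk e t * e t = (∑ t, e t) ^ 2 - ∑ t, e t * e t := by
  have h1 : ∑ t, walk e t * e t = ∑ t, ∑ s, if s < t then e s * e t else 0 := by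
    refine Finset.sum_congr rfl fun t _ => ?_
    rw [walk, Finset.sum_mul]
    exact Finset.sum_congr rfl fun s _ => by split_ifs <;> simp
  have h2 : ∑ t, walk e t * e t = ∑ t, ∑ s, if t < s then e s * e t else 0 := by
    rw [h1, Finset.sum_comm]
    exact Finset.sum_congr rfl fun t _ => Finset.sum_congr rfl fun s _ => by rw [mul_comm]
  have h3 : (∑ t, e t) ^ 2 = ∑ t, ∑ s, e s * e t := by
    rw [sq, Finset.sum_mul_sum, Finset.sum_comm]
  have h4 : ∑ t, e t * e t = ∑ t, ∑ s, if s = t then e s * e t else 0 := by simp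
  rw [two_mul]
  nth_rw 1 [h1]
  rw [h2, h3, h4, ← Finset.sum_add_distrib, ← Finset.sum_sub_distrib]
  refine Finset.sum_congr rfl fun t _ => ?_
  rw [← Finset.sum_add_distrib, ← Finset.sum_sub_distrib]
  refine Finset.sum_congr rfl fun s _ => ?_
  rcases lt_trichotomy s t with h | h | h
  · simp [h, h.not_gt, h.ne]
  · simp [h]
  · simp [h, h.not_gt, h.ne']

/-- The contribution of a unit to the score at `r = 1`. -/
def unitScore (e : Fin T → ℝ) : ℝ := withinForm e e / 2 + withinForm (walk e) e

/-- Since `2 ∑ w_t e_t = (∑ e_t) ^ 2 - ∑ e_t ^ 2`, the squares `e_t ^ 2` cancel against those of `e'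
Q e` and a product of two linear forms is left. The nondegeneracy hypothesis thus says that the unit
score is not almost surely zero. -/
lemma unitScore_eq (hT : T ≠ 0) (e : Fin T → ℝ) :
    unitScore e = (T : ℝ)⁻¹ *
      ((∑ t, e t) * ∑ t : Fin T, ((t : ℝ) + 1 - ((T : ℝ) + 1) / 2) * e t) := by
  have hT' : (T : ℝ) ≠ 0 := by exact_mod_cast hT
  have h1 := sum_walk_mul e
  have h2 := sum_walk e
  have h3 : ∑ t : Fin T, ((t : ℝ) + 1 - ((T : ℝ) + 1) / 2) * e t
      = ((T : ℝ) - 1) / 2 * (∑ t, e t) - ∑ s : Fin T, ((T : ℝ) - 1 - s) * e s := by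
    rw [Finset.mul_sum, ← Finset.sum_sub_distrib]
    exact Finset.sum_congr rfl fun t _ => by ring
  unfold unitScore
  rw [withinForm_eq, withinForm_eq, h2, h3]
  have h4 : ∑ t, walk e t * e t = ((∑ t, e t) ^ 2 - ∑ t, e t * e t) / 2 := by linarith
  rw [h4]
  field_simp
  ring

section Moments

variable {ε : Ω → Fin T → ℝ} {σ2 : ℝ}

lemma integral_linear_mul_linear (hL : ∀ t, MemLp (fun ω => ε ω t) 2 P)
    (hvar : ∀ s t, ∫ ω, ε ω s * ε ω t ∂P = if s = t then σ2 else 0) (a b : Fin T → ℝ) :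
    ∫ ω, (a ⬝ᵥ ε ω) * (b ⬝ᵥ ε ω) ∂P = σ2 * (a ⬝ᵥ b) := by
  have hint : ∀ s t, Integrable (fun ω => ε ω s * ε ω t) P :=
    fun s t => (hL s).integrable_mul (hL t)
  have h1 : ∀ ω, (a ⬝ᵥ ε ω) * (b ⬝ᵥ ε ω) = ∑ s, ∑ t, (a s * b t) * (ε ω s * ε ω t) := by
    intro ω
    simp only [dotProduct]
    rw [Finset.sum_mul_sum]
    exact Finset.sum_congr rfl fun s _ => Finset.sum_congr rfl fun t _ => by ring
  simp only [h1]
  rw [integral_finsetSum _ fun s _ => integrable_finsetSum _ fun t _ => (hint s t).const_mul _]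
  have h2 : ∀ s, ∫ ω, ∑ t, (a s * b t) * (ε ω s * ε ω t) ∂P = σ2 * (a s * b s) := by
    intro s
    rw [integral_finsetSum _ fun t _ => (hint s t).const_mul _]
    simp only [integral_const_mul, hvar]
    simp
    ring
  simp only [h2, dotProduct, Finset.mul_sum]

lemma integrable_linear_mul_linear (hL : ∀ t, MemLp (fun ω => ε ω t) 2 P) (a b : Fin T → ℝ) :
    Integrable (fun ω => (a ⬝ᵥ ε ω) * (b ⬝ᵥ ε ω)) P := by
  have h : ∀ a : Fin T → ℝ, MemLp (fun ω => a ⬝ᵥ ε ω) 2 P := fun a =>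
    memLp_finsetSum _ fun t _ => (hL t).const_mul (a t)
  exact (h a).integrable_mul (h b)

lemma sum_mulVec_eq (A : Matrix (Fin T) (Fin T) ℝ) (e : Fin T → ℝ) :
    ∑ t, (A *ᵥ e) t = (fun s => ∑ t, A t s) ⬝ᵥ e := by
  simp only [Matrix.mulVec, dotProduct, Finset.sum_mul]
  exact Finset.sum_comm

/-- The right side is `σ²` times the trace of `A' Q B`, written with column sums; the three
population coefficients follow with `A`, `B` the identity or `walkMatrix T`. -/
lemma integral_withinForm_mulVec (hL : ∀ t, MemLp (fun ω => ε ω t) 2 P)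
    (hvar : ∀ s t, ∫ ω, ε ω s * ε ω t ∂P = if s = t then σ2 else 0)
    (A B : Matrix (Fin T) (Fin T) ℝ) :
    ∫ ω, withinForm (A *ᵥ ε ω) (B *ᵥ ε ω) ∂P
      = σ2 * (∑ t, ∑ s, A t s * B t s - (T : ℝ)⁻¹ * ∑ s, (∑ t, A t s) * ∑ t, B t s) := by
  have h1 : ∀ ω, withinForm (A *ᵥ ε ω) (B *ᵥ ε ω) = ∑ t, (A.row t ⬝ᵥ ε ω) * (B.row t ⬝ᵥ ε ω)
      - (T : ℝ)⁻¹ * (((fun s => ∑ t, A t s) ⬝ᵥ ε ω) * ((fun s => ∑ t, B t s) ⬝ᵥ ε ω)) := by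
    intro ω
    rw [withinForm_eq, sum_mulVec_eq, sum_mulVec_eq, mul_assoc]
    rfl
  simp only [h1]
  rw [integral_sub (integrable_finsetSum _ fun t _ => integrable_linear_mul_linear hL _ _)
    ((integrable_linear_mul_linear hL _ _).const_mul _), integral_const_mul,
    integral_finsetSum _ fun t _ => integrable_linear_mul_linear hL _ _]
  simp only [integral_linear_mul_linear hL hvar]
  rw [← Finset.mul_sum]
  simp only [dotProduct, Matrix.row_apply]
  ring

lemma sum_walkMatrix_row (t : Fin T) : ∑ s, walkMatrix T t s = t := by
  simp only [walkMatrix, Matrix.of_apply]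
  rw [← Finset.sum_filter, Finset.sum_const, nsmul_eq_mul, mul_one]
  have : (Finset.univ.filter fun s : Fin T => s < t) = Finset.Iio t := by ext s; simp
  rw [this, Fin.card_Iio]

lemma sum_walkMatrix_col (s : Fin T) : ∑ t, walkMatrix T t s = (T : ℝ) - 1 - s := by
  have h := sum_walk (T := T) (Pi.single s 1)
  rw [walk_eq_mulVec, sum_mulVec_eq] at h
  simpa [dotProduct, Pi.single_apply] using h

lemma sum_fin_cast (T : ℕ) : ∑ t : Fin T, (t : ℝ) = T * ((T : ℝ) - 1) / 2 := by
  rw [Fin.sum_univ_eq_sum_range (fun k => (k : ℝ)) T]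
  induction T with
  | zero => simp
  | succ n ih => rw [Finset.sum_range_succ, ih]; push_cast; ring

lemma sum_fin_cast_sq (T : ℕ) :
    ∑ t : Fin T, (t : ℝ) ^ 2 = T * ((T : ℝ) - 1) * (2 * T - 1) / 6 := by
  rw [Fin.sum_univ_eq_sum_range (fun k => (k : ℝ) ^ 2) T]
  induction T with
  | zero => simp
  | succ n ih => rw [Finset.sum_range_succ, ih]; push_cast; ring

lemma integral_withinForm (hT : T ≠ 0) (hL : ∀ t, MemLp (fun ω => ε ω t) 2 P)
    (hvar : ∀ s t, ∫ ω, ε ω s * ε ω t ∂P = if s = t then σ2 else 0) :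
    ∫ ω, withinForm (ε ω) (ε ω) ∂P = σ2 * ((T : ℝ) - 1) := by
  have hT' : (T : ℝ) ≠ 0 := by exact_mod_cast hT
  have h := integral_withinForm_mulVec hL hvar 1 1
  simp only [Matrix.one_mulVec] at h
  rw [h]
  simp [Matrix.one_apply]
  field_simp
  simp

/-- The walk uses only earlier errors, so the covariance comes entirely from demeaning. The value is
minus half the mean of `e' Q e`, which `ξ'(1) = 1/2` offsets. -/
lemma integral_withinForm_walk (hT : T ≠ 0) (hL : ∀ t, MemLp (fun ω => ε ω t) 2 P)
    (hvar : ∀ s t, ∫ ω, ε ω s * ε ω t ∂P = if s = t then σ2 else 0) :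
    ∫ ω, withinForm (walk (ε ω)) (ε ω) ∂P = -(σ2 * ((T : ℝ) - 1) / 2) := by
  have hT' : (T : ℝ) ≠ 0 := by exact_mod_cast hT
  have h := integral_withinForm_mulVec hL hvar (walkMatrix T) 1
  simp only [Matrix.one_mulVec, ← walk_eq_mulVec, sum_walkMatrix_col] at h
  rw [h]
  have h1 : ∑ t : Fin T, ∑ s, walkMatrix T t s * (1 : Matrix (Fin T) (Fin T) ℝ) t s = 0 :=
    Finset.sum_eq_zero fun t _ => by simp [Matrix.one_apply, walkMatrix]
  have h2 : ∑ s : Fin T, ((T : ℝ) - 1 - s) * ∑ t, (1 : Matrix (Fin T) (Fin T) ℝ) t s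
      = T * ((T : ℝ) - 1) / 2 := by
    simp only [Matrix.one_apply, Finset.sum_ite_eq', Finset.mem_univ, if_true, mul_one,
      Finset.sum_sub_distrib, sum_fin_cast]
    simp
    ring
  rw [h1, h2]
  field_simp
  ring

lemma integral_withinForm_walk_walk (hT : T ≠ 0) (hL : ∀ t, MemLp (fun ω => ε ω t) 2 P)
    (hvar : ∀ s t, ∫ ω, ε ω s * ε ω t ∂P = if s = t then σ2 else 0) :
    ∫ ω, withinForm (walk (ε ω)) (walk (ε ω)) ∂P
      = σ2 * ((T : ℝ) - 1) * (((T : ℝ) + 1) / 6) := by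
  have hT' : (T : ℝ) ≠ 0 := by exact_mod_cast hT
  have h := integral_withinForm_mulVec hL hvar (walkMatrix T) (walkMatrix T)
  simp only [← walk_eq_mulVec, sum_walkMatrix_col] at h
  rw [h]
  have h1 : ∑ t : Fin T, ∑ s, walkMatrix T t s * walkMatrix T t s = T * ((T : ℝ) - 1) / 2 := by
    rw [← sum_fin_cast]
    refine Finset.sum_congr rfl fun t _ => ?_
    rw [← sum_walkMatrix_row]
    exact Finset.sum_congr rfl fun s _ => by simp [walkMatrix]
  have h2 : ∑ s : Fin T, ((T : ℝ) - 1 - s) * ((T : ℝ) - 1 - s)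
      = T * ((T : ℝ) - 1) * (2 * T - 1) / 6 := by
    have h3 : ∀ s : Fin T, ((T : ℝ) - 1 - s) * ((T : ℝ) - 1 - s)
        = ((T : ℝ) - 1) ^ 2 - 2 * ((T : ℝ) - 1) * s + (s : ℝ) ^ 2 := fun s => by ring
    simp only [h3, Finset.sum_add_distrib, Finset.sum_sub_distrib, ← Finset.mul_sum,
      sum_fin_cast, sum_fin_cast_sq]
    simp
    ring
  rw [h1, h2]
  field_simp
  ring

lemma memLp_mul_of_four {f g : Ω → ℝ} (hf : MemLp f 4 P) (hg : MemLp g 4 P) :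
    MemLp (fun ω => f ω * g ω) 2 P := by
  have : ENNReal.HolderTriple 4 4 2 := ⟨by
    rw [← two_mul]
    have h : (4 : ENNReal) = 2 * 2 := by norm_num
    rw [h, ENNReal.mul_inv (by simp) (by simp), ← mul_assoc,
      ENNReal.mul_inv_cancel (by simp) (by simp), one_mul]⟩
  exact hg.mul' hf

lemma memLp_withinForm_mulVec (h4 : ∀ t, MemLp (fun ω => ε ω t) 4 P)
    (A B : Matrix (Fin T) (Fin T) ℝ) :
    MemLp (fun ω => withinForm (A *ᵥ ε ω) (B *ᵥ ε ω)) 2 P := by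
  have h : ∀ a : Fin T → ℝ, MemLp (fun ω => a ⬝ᵥ ε ω) 4 P := fun a =>
    memLp_finsetSum _ fun t _ => (h4 t).const_mul (a t)
  have h1 : (fun ω => withinForm (A *ᵥ ε ω) (B *ᵥ ε ω)) = fun ω =>
      ∑ t, (A.row t ⬝ᵥ ε ω) * (B.row t ⬝ᵥ ε ω)
      - (T : ℝ)⁻¹ * (((fun s => ∑ t, A t s) ⬝ᵥ ε ω) * ((fun s => ∑ t, B t s) ⬝ᵥ ε ω)) := by
    funext ω
    rw [withinForm_eq, sum_mulVec_eq, sum_mulVec_eq, mul_assoc]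
    rfl
  rw [h1]
  exact (memLp_finsetSum _ fun t _ => memLp_mul_of_four (h _) (h _)).sub
    ((memLp_mul_of_four (h _) (h _)).const_mul _)

end Moments

/-- Rewrites the moment through `Q X`, since independence and identical distribution are assumed for
`Q X_i` and not for `X_i`. -/
lemma crossMoment_eq (Xi : Matrix (Fin T) (Fin K) ℝ) (e : Fin T → ℝ) (k : Fin K) :
    crossMoment Xi e k = ∑ t, (Q T * Xi) t k * e t := by
  have h : Xiᵀ * Q T = (Q T * Xi)ᵀ := by rw [Matrix.transpose_mul, Q_transpose]
  unfold crossMoment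
  rw [h]
  rfl

lemma gram_entry_eq (hT : T ≠ 0) (Xi : Matrix (Fin T) (Fin K) ℝ) (k l : Fin K) :
    (Xiᵀ * Q T * Xi) k l = ∑ t, (Q T * Xi) t k * (Q T * Xi) t l := by
  have h : Xiᵀ * Q T * Xi = (Q T * Xi)ᵀ * (Q T * Xi) := by
    rw [Matrix.transpose_mul, Q_transpose, Matrix.mul_assoc, Matrix.mul_assoc,
      ← Matrix.mul_assoc (Q T) (Q T), Q_mul_self hT]
  rw [h, Matrix.mul_apply]
  rfl

/-- The product of independent square integrable variables is square integrable. -/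
lemma memLp_mul_of_indepFun {f g : Ω → ℝ} (hf : MemLp f 2 P) (hg : MemLp g 2 P)
    (h : IndepFun f g P) : MemLp (fun ω => f ω * g ω) 2 P := by
  refine (memLp_two_iff_integrable_sq (hf.1.mul hg.1)).2 ?_
  have h2 : IndepFun (fun ω => f ω ^ 2) (fun ω => g ω ^ 2) P :=
    h.comp (φ := fun x : ℝ => x ^ 2) (ψ := fun x : ℝ => x ^ 2) (by fun_prop) (by fun_prop)
  refine (h2.integrable_mul hf.integrable_sq hg.integrable_sq).congr (ae_of_all _ fun ω => ?_)
  simp only [Pi.mul_apply]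
  ring

end

/-! ### Concentration and asymptotic normality under the model -/

section

variable {Ω : Type*} [MeasurableSpace Ω] {P : Measure Ω} {T K : ℕ}

/-- Matrix inversion is bounded near an invertible matrix. -/
lemma exists_inv_bound (D : Matrix (Fin K) (Fin K) ℝ) (hD : D.det ≠ 0) :
    ∃ M δ : ℝ, 0 ≤ M ∧ 0 < δ ∧ ∀ D' : Matrix (Fin K) (Fin K) ℝ,
      (∀ k l, |D' k l - D k l| < δ) → IsUnit D'.det ∧ ∀ k l, |D'⁻¹ k l| ≤ M := by
  have hof : Continuous fun f : Fin K → Fin K → ℝ => Matrix.of f :=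
    continuous_matrix fun i j => by
      simp only [Matrix.of_apply]
      fun_prop
  set f₀ : Fin K → Fin K → ℝ := fun k l => D k l with hf₀
  have hD0 : Matrix.of f₀ = D := rfl
  have hdet : Continuous fun f : Fin K → Fin K → ℝ => (Matrix.of f).det := hof.matrix_det
  have hadj : ∀ k l, Continuous fun f : Fin K → Fin K → ℝ => (Matrix.of f).adjugate k l :=
    fun k l => hof.matrix_adjugate.matrix_elem k l
  set M : ℝ := ∑ k, ∑ l, |D.det⁻¹ * D.adjugate k l| + 1 with hM
  have e1 : ∀ᶠ f in 𝓝 f₀, (Matrix.of f).det ≠ 0 :=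
    (hdet.tendsto f₀).eventually_ne (by rw [hD0]; exact hD)
  have e2 : ∀ᶠ f in 𝓝 f₀, ∀ k l, |(Matrix.of f).det⁻¹ * (Matrix.of f).adjugate k l| < M := by
    rw [eventually_all]
    intro k
    rw [eventually_all]
    intro l
    have hc : ContinuousAt (fun f : Fin K → Fin K → ℝ =>
        |(Matrix.of f).det⁻¹ * (Matrix.of f).adjugate k l|) f₀ :=
      ((hdet.continuousAt.inv₀ (by rw [hD0]; exact hD)).mul (hadj k l).continuousAt).abs
    refine hc.eventually (gt_mem_nhds ?_)
    change |(Matrix.of f₀).det⁻¹ * (Matrix.of f₀).adjugate k l| < M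
    rw [hD0, hM]
    have h1 : |D.det⁻¹ * D.adjugate k l| ≤ ∑ l, |D.det⁻¹ * D.adjugate k l| :=
      Finset.single_le_sum (f := fun l => |D.det⁻¹ * D.adjugate k l|)
        (fun _ _ => abs_nonneg _) (Finset.mem_univ l)
    have h2 : ∑ l, |D.det⁻¹ * D.adjugate k l| ≤ ∑ k, ∑ l, |D.det⁻¹ * D.adjugate k l| :=
      Finset.single_le_sum (f := fun k => ∑ l, |D.det⁻¹ * D.adjugate k l|)
        (fun _ _ => Finset.sum_nonneg fun _ _ => abs_nonneg _) (Finset.mem_univ k)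
    linarith
  obtain ⟨δ, hδ, hball⟩ := Metric.eventually_nhds_iff.1 (e1.and e2)
  refine ⟨M, δ, by positivity, hδ, fun D' hD' => ?_⟩
  have hdist : dist (fun k l => D' k l : Fin K → Fin K → ℝ) f₀ < δ :=
    (dist_pi_lt_iff hδ).2 fun k => (dist_pi_lt_iff hδ).2 fun l => by
      rw [Real.dist_eq]; exact hD' k l
  obtain ⟨h1, h2⟩ := hball hdist
  have hD1 : Matrix.of (fun k l => D' k l) = D' := rfl
  rw [hD1] at h1 h2
  refine ⟨isUnit_iff_ne_zero.2 h1, fun k l => ?_⟩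
  rw [Matrix.inv_def, Ring.inverse_eq_inv', Matrix.smul_apply, smul_eq_mul]
  exact (h2 k l).le

section Sample

variable {σ2 : ℝ} {βc : Fin K → ℝ} {μ : ℕ → Ω → ℝ} {y : ℕ → Ω → Fin (T + 1) → ℝ}
  {X : ℕ → Ω → Matrix (Fin T) (Fin K) ℝ} {ε : ℕ → Ω → Fin T → ℝ}

lemma Model.ae_random_walk (hM : Model P 1 σ2 βc μ y X ε) :
    ∀ᵐ ω ∂P, ∀ i, ∀ t : Fin T, y i ω t.succ = y i ω t.castSucc + ε i ω t := by
  filter_upwards [ae_all_iff.2 hM.eqn] with ω hω i t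
  rw [hω i t]
  simp

lemma Model.iIndepFun_comp (hM : Model P 1 σ2 βc μ y X ε)
    {φ : (Fin T → ℝ) × (Fin T → Fin K → ℝ) → ℝ} (hφ : Measurable φ) :
    iIndepFun (fun i ω => φ (ε i ω, demeaned X i ω)) P :=
  hM.indep.comp (fun _ z => φ (z.1, z.2.2)) fun _ => by fun_prop

lemma Model.identDistrib_comp (hM : Model P 1 σ2 βc μ y X ε)
    {φ : (Fin T → ℝ) × (Fin T → Fin K → ℝ) → ℝ} (hφ : Measurable φ) (i : ℕ) :
    IdentDistrib (fun ω => φ (ε i ω, demeaned X i ω)) (fun ω => φ (ε 0 ω, demeaned X 0 ω)) P P :=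
  (hM.ident i).comp (u := fun z : (Fin T → ℝ) × ℝ × (Fin T → Fin K → ℝ) => φ (z.1, z.2.2))
    (by fun_prop)

lemma Model.aemeasurable_demeaned (hM : Model P 1 σ2 βc μ y X ε) (t : Fin T) (k : Fin K) :
    AEMeasurable (fun ω => demeaned X 0 ω t k) P :=
  (hM.identDistrib_comp (φ := fun z => z.2 t k) (by fun_prop) 0).aemeasurable_fst

lemma Model.memLp_demeaned (hM : Model P 1 σ2 βc μ y X ε) (t : Fin T) (k : Fin K) :
    MemLp (fun ω => demeaned X 0 ω t k) 2 P := by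
  have hT : T ≠ 0 := by have := hM.two_le; omega
  rw [memLp_two_iff_integrable_sq (hM.aemeasurable_demeaned t k).aestronglyMeasurable]
  refine (hM.cov_integrable 0 k k).mono'
    ((hM.aemeasurable_demeaned t k).pow_const 2).aestronglyMeasurable (ae_of_all _ fun ω => ?_)
  rw [gram_entry_eq hT, Real.norm_eq_abs, abs_of_nonneg (sq_nonneg _)]
  have := Finset.single_le_sum (f := fun t => (Q T * X 0 ω) t k * (Q T * X 0 ω) t k)
    (fun t _ => mul_self_nonneg _) (Finset.mem_univ t)
  simpa [demeaned, sq] using this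

lemma Model.indepFun_mul (hM : Model P 1 σ2 βc μ y X ε) (t : Fin T) (k : Fin K) (a : Fin T → ℝ) :
    IndepFun (fun ω => demeaned X 0 ω t k) (fun ω => a ⬝ᵥ ε 0 ω) P :=
  ((hM.exog 0).comp (φ := fun e : Fin T → ℝ => a ⬝ᵥ e)
    (ψ := fun z : ℝ × (Fin T → Fin K → ℝ) => z.2 t k)
    (by unfold dotProduct; fun_prop) (by fun_prop)).symm

lemma Model.memLp_linear (hM : Model P 1 σ2 βc μ y X ε) (a : Fin T → ℝ) :
    MemLp (fun ω => a ⬝ᵥ ε 0 ω) 2 P :=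
  memLp_finsetSum _ fun t _ => (hM.eps_memLp 0 t).const_mul (a t)

lemma Model.integral_linear [IsProbabilityMeasure P] (hM : Model P 1 σ2 βc μ y X ε)
    (a : Fin T → ℝ) : ∫ ω, a ⬝ᵥ ε 0 ω ∂P = 0 := by
  unfold dotProduct
  rw [integral_finsetSum _ fun t _ =>
    ((hM.eps_memLp 0 t).integrable (by norm_num)).const_mul (a t)]
  simp [integral_const_mul, hM.eps_mean]

/-- Cross moments of the covariates and linear transforms of the errors average out. -/
lemma Model.negligible_crossMoment [IsProbabilityMeasure P] (hM : Model P 1 σ2 βc μ y X ε)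
    (A : Matrix (Fin T) (Fin T) ℝ) (k : Fin K) {τ : ℝ} (hτ : 0 < τ) :
    Negligible P fun N =>
      {ω | band τ N < |avg N fun i => crossMoment (X i ω) (A *ᵥ ε i ω) k|} := by
  set φ : (Fin T → ℝ) × (Fin T → Fin K → ℝ) → ℝ := fun z => ∑ t, z.2 t k * (A.row t ⬝ᵥ z.1)
  have hφ : Measurable φ := by
    simp only [φ, dotProduct]
    fun_prop
  have hφeq : ∀ i ω, crossMoment (X i ω) (A *ᵥ ε i ω) k = φ (ε i ω, demeaned X i ω) :=
    fun i ω => crossMoment_eq _ _ _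
  have hmul : ∀ t, MemLp (fun ω => demeaned X 0 ω t k * (A.row t ⬝ᵥ ε 0 ω)) 2 P := fun t =>
    memLp_mul_of_indepFun (hM.memLp_demeaned t k) (hM.memLp_linear _) (hM.indepFun_mul t k _)
  have hmean : ∫ ω, φ (ε 0 ω, demeaned X 0 ω) ∂P = 0 := by
    simp only [φ]
    rw [integral_finsetSum _ fun t _ => (hmul t).integrable (by norm_num)]
    refine Finset.sum_eq_zero fun t _ => ?_
    rw [(hM.indepFun_mul t k _).integral_fun_mul_eq_mul_integral (hM.memLp_demeaned t k).1
      (hM.memLp_linear _).1, hM.integral_linear, mul_zero]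
  have := negligible_avg_sub (hM.iIndepFun_comp hφ) (hM.identDistrib_comp hφ)
    (memLp_finsetSum _ fun t _ => hmul t) hmean hτ
  simpa only [hφeq, sub_zero] using this

/-- Quadratic forms in the errors are close to their means. -/
lemma Model.negligible_withinForm [IsProbabilityMeasure P] (hM : Model P 1 σ2 βc μ y X ε)
    (h4 : ∀ t, MemLp (fun ω => ε 0 ω t) 4 P) (A B : Matrix (Fin T) (Fin T) ℝ) {m : ℝ}
    (hm : ∫ ω, withinForm (A *ᵥ ε 0 ω) (B *ᵥ ε 0 ω) ∂P = m) {τ : ℝ} (hτ : 0 < τ) :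
    Negligible P fun N =>
      {ω | band τ N < |(avg N fun i => withinForm (A *ᵥ ε i ω) (B *ᵥ ε i ω)) - m|} := by
  have hφ : Measurable fun z : (Fin T → ℝ) × (Fin T → Fin K → ℝ) =>
      withinForm (A *ᵥ z.1) (B *ᵥ z.1) := by
    simp only [withinForm, Matrix.mulVec, dotProduct]
    fun_prop
  exact negligible_avg_sub (hM.iIndepFun_comp hφ) (hM.identDistrib_comp hφ)
    (memLp_withinForm_mulVec h4 A B) hm hτ

lemma Model.negligible_gram [IsProbabilityMeasure P] (hM : Model P 1 σ2 βc μ y X ε)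
    (k l : Fin K) {δ : ℝ} (hδ : 0 < δ) :
    Negligible P fun N => {ω | δ ≤ |gram N (fun i => X i ω) k l
      - ∫ ω, ((X 0 ω)ᵀ * Q T * X 0 ω) k l ∂P|} := by
  have hT : T ≠ 0 := by have := hM.two_le; omega
  have hφ : Measurable fun z : (Fin T → ℝ) × (Fin T → Fin K → ℝ) =>
      ∑ t, z.2 t k * z.2 t l := by fun_prop
  have hφeq : ∀ i ω, ((X i ω)ᵀ * Q T * X i ω) k l
      = ∑ t, demeaned X i ω t k * demeaned X i ω t l := fun i ω => gram_entry_eq hT _ _ _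
  have hint := hM.cov_integrable 0 k l
  simp only [hφeq] at hint
  have := negligible_avg_sub_const (hM.iIndepFun_comp hφ) (hM.identDistrib_comp hφ) hint hδ
  simpa only [gram, Matrix.of_apply, hφeq] using this

/-- The sample moments concentrate. -/
lemma Model.exists_negligible_not_momentsNear [IsProbabilityMeasure P]
    (hM : Model P 1 σ2 βc μ y X ε) (h4 : ∀ t, MemLp (fun ω => ε 0 ω t) 4 P) :
    ∃ M, 0 ≤ M ∧ ∀ τ, 0 < τ → Negligible P fun N =>
      {ω | ¬ MomentsNear σ2 M (band τ N) N (fun i => X i ω) (fun i => ε i ω)} := by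
  have hT : T ≠ 0 := by have := hM.two_le; omega
  have hL := hM.eps_memLp 0
  have hvar := hM.eps_var 0
  -- The Gram matrix needs only a fixed accuracy `δ`, so the weak law suffices there and no fourth
  -- moments of the covariates are required.
  obtain ⟨M, δ, hM0, hδ, hinv⟩ := exists_inv_bound _ (hM.cov_posDef 0).det_pos.ne'
  refine ⟨M, hM0, fun τ hτ => ?_⟩
  have m1 := integral_withinForm hT hL hvar
  have m2 := integral_withinForm_walk hT hL hvar
  have m3 := integral_withinForm_walk_walk hT hL hvar
  have b1 := hM.negligible_withinForm h4 1 1 (by simpa using m1) hτ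
  have b2 := hM.negligible_withinForm h4 (walkMatrix T) 1
    (by simpa [← walk_eq_mulVec] using m2) hτ
  have b3 := hM.negligible_withinForm h4 (walkMatrix T) (walkMatrix T)
    (by simpa only [← walk_eq_mulVec] using m3) hτ
  have b4 := Negligible.iUnion fun k => hM.negligible_crossMoment 1 k hτ
  have b5 := Negligible.iUnion fun k => hM.negligible_crossMoment (walkMatrix T) k hτ
  have b6 := Negligible.iUnion fun k => Negligible.iUnion fun l => hM.negligible_gram k l hδ
  refine (((((b1.union b2).union b3).union b4).union b5).union b6).mono fun N ω hω => ?_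
  by_contra hcon
  simp only [Set.mem_union, Set.mem_iUnion, Set.mem_ofPred_eq, not_or, not_exists, not_lt, not_le,
    Matrix.one_mulVec, ← walk_eq_mulVec] at hcon hω
  obtain ⟨⟨⟨⟨⟨c1, c2⟩, c3⟩, c4⟩, c5⟩, c6⟩ := hcon
  have hg := hinv (gram N fun i => X i ω) c6
  rw [sub_neg_eq_add] at c2
  exact hω ⟨c1, c2, c3, c4, c5, hg.1, hg.2⟩

/-- Outside a negligible event the sign of the leading term of the score at `r = 1` decides
between the absence of stationary points and an interior local maximum. -/
lemma Model.negligible_not_splits [IsProbabilityMeasure P]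
    (hM : Model P 1 σ2 βc μ y X ε) (h4 : ∀ t, MemLp (fun ω => ε 0 ω t) 4 P) {x : ℝ} (hx : 0 < x) :
    Negligible P fun N => {ω | ¬ ∃ A B C D,
      Splits (fun i => y i ω) (fun i => X i ω) N A B C D ∧ 0 < A ∧ B ^ 2 < A * C ∧
        0 < score T A B C 0 ∧
        (x < √N * scoreAvg N (fun i => ε i ω) → ∀ r, -1 ≤ r → 0 < score T A B C r) ∧
        (√N * scoreAvg N (fun i => ε i ω) < -x → score T A B C 1 < 0)} := by
  obtain ⟨M, hM0, hneg⟩ := hM.exists_negligible_not_momentsNear h4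
  obtain ⟨L, u₀, hL, hu₀, hthr⟩ :=
    exists_score_threshold (T := T) (K := K) hM.two_le hM.sigma2_pos hM0
  have hτ : 0 < x / L := by positivity
  have b1 := hneg _ hτ
  have b2 := negligible_of_null (P := P) (ae_iff.1 hM.ae_random_walk)
  have hev : ∀ᶠ N in atTop, N ≠ 0 ∧ band (x / L) N ≤ u₀ :=
    (eventually_ne_atTop 0).and ((tendsto_band (x / L)).eventually (ge_mem_nhds hu₀))
  have b3 : Negligible P fun N => {_ω : Ω | ¬ (N ≠ 0 ∧ band (x / L) N ≤ u₀)} :=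
    negligible_of_eventually_empty (by
      filter_upwards [hev] with N hN
      ext ω
      simp only [Set.mem_ofPred_eq, Set.mem_empty_iff_false, iff_false, not_not]
      exact hN)
  refine ((b1.union b2).union b3).mono fun N ω hω => ?_
  by_contra hcon
  simp only [Set.mem_union, Set.mem_ofPred_eq, not_or, not_not] at hcon hω
  obtain ⟨⟨c1, c2⟩, c3, c4⟩ := hcon
  refine hω ?_
  obtain ⟨A, B, C, D, h1, h2, h3, h5, h6, h7⟩ := hthr (band (x / L) N) N (fun i => y i ω) (fun i => X i ω)
    (fun i => ε i ω) (Real.sqrt_nonneg _) c4 c3 (fun i _ => c2 i) c1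
  have hN : 0 < √(N : ℝ) := Real.sqrt_pos.2 (by exact_mod_cast Nat.pos_of_ne_zero c3)
  have hLu : L * band (x / L) N ^ 2 = x / √N := by
    rw [band_sq hτ.le]
    field_simp
  rw [hLu] at h6 h7
  refine ⟨A, B, C, D, h1, h2, h3, h5, fun h => h6 ?_, fun h => h7 ?_⟩
  · rw [div_lt_iff₀ hN]
    linarith
  · rw [← neg_div, lt_div_iff₀ hN]
    linarith

/-- The leading term of the score at `r = 1` is asymptotically normal. -/
lemma Model.exists_tendsto_scoreAvg [IsProbabilityMeasure P]
    (hM : Model P 1 σ2 βc μ y X ε) (h4 : ∀ t, MemLp (fun ω => ε 0 ω t) 4 P)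
    (hnd : ¬ ∀ᵐ ω ∂P,
      (∑ t, ε 0 ω t) * (∑ t : Fin T, ((t : ℝ) + 1 - ((T : ℝ) + 1) / 2) * ε 0 ω t) = 0) :
    ∃ v : NNReal, v ≠ 0 ∧ ∀ (E : Set ℝ) (x : ℝ), MeasurableSet E → frontier E ⊆ {x} →
      Tendsto (fun N : ℕ => P {ω | √N * scoreAvg N (fun i => ε i ω) ∈ E}) atTop
        (𝓝 (gaussianReal 0 v E)) := by
  have hT : T ≠ 0 := by have := hM.two_le; omega
  have hφ : Measurable fun z : (Fin T → ℝ) × (Fin T → Fin K → ℝ) => unitScore z.1 := by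
    simp only [unitScore, walk_eq_mulVec, withinForm, Matrix.mulVec, dotProduct]
    fun_prop
  have l1 : MemLp (fun ω => withinForm (ε 0 ω) (ε 0 ω)) 2 P := by
    simpa using memLp_withinForm_mulVec h4 1 1
  have l2 : MemLp (fun ω => withinForm (walk (ε 0 ω)) (ε 0 ω)) 2 P := by
    simpa [← walk_eq_mulVec] using memLp_withinForm_mulVec h4 (walkMatrix T) 1
  have hU : MemLp (fun ω => unitScore (ε 0 ω)) 2 P := by
    have := (l1.mul_const 2⁻¹).add l2
    simpa only [unitScore, div_eq_mul_inv] using! this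
  have hmean : ∫ ω, unitScore (ε 0 ω) ∂P = 0 := by
    unfold unitScore
    rw [integral_add ((l1.integrable (by norm_num)).div_const 2) (l2.integrable (by norm_num)),
      integral_div, integral_withinForm hT (hM.eps_memLp 0) (hM.eps_var 0),
      integral_withinForm_walk hT (hM.eps_memLp 0) (hM.eps_var 0)]
    ring
  -- The unit score has mean zero, so zero variance would make it vanish almost surely.
  have hv : Var[fun ω => unitScore (ε 0 ω); P].toNNReal ≠ 0 := by
    intro h0
    have h1 : Var[fun ω => unitScore (ε 0 ω); P] = 0 :=
      le_antisymm (Real.toNNReal_eq_zero.1 h0) (variance_nonneg _ _)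
    apply hnd
    filter_upwards [ae_eq_integral_of_variance_eq_zero hU h1] with ω hω
    rw [hmean, unitScore_eq hT] at hω
    have hT' : (T : ℝ)⁻¹ ≠ 0 := inv_ne_zero (by exact_mod_cast hT)
    exact (mul_eq_zero.1 hω).resolve_left hT'
  exact ⟨_, hv, fun E x hE hfr => tendsto_measure_sqrt_mul_avg (hM.iIndepFun_comp hφ)
    (hM.identDistrib_comp hφ) hU hmean hv hE hfr⟩

end Sample

end

end PanelAR1

end

/-! ### Nonexistence of maxima and inconsistency at the unit root -/

theorem lemma4 {Ω : Type*} [MeasurableSpace Ω] (P : Measure Ω) [IsProbabilityMeasure P]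
    {T K : ℕ} (ρ σ2 : ℝ) (βc : Fin K → ℝ) (μ : ℕ → Ω → ℝ)
    (y : ℕ → Ω → Fin (T + 1) → ℝ) (X : ℕ → Ω → Matrix (Fin T) (Fin K) ℝ)
    (ε : ℕ → Ω → Fin T → ℝ)
    (hM : PanelAR1.Model P ρ σ2 βc μ y X ε)
    (hρ : ρ = 1)
    (h_four : ∀ t, MemLp (fun ω => ε 0 ω t) 4 P)
    (h_nondeg : ¬ ∀ᵐ ω ∂P,
      (∑ t, ε 0 ω t) * (∑ t : Fin T, ((t : ℝ) + 1 - ((T : ℝ) + 1) / 2) * ε 0 ω t) = 0) :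
    (∃ p : ℝ, 0 < p ∧
      Tendsto (fun N : ℕ =>
        P.real {ω | PanelAR1.profMaxima (fun i => y i ω) (fun i => X i ω) N = ∅})
        atTop (𝓝 p)) ∧
    (∀ S : Set (PanelAR1.Param K), IsOpen S → PanelAR1.restrParam K ⊆ S →
      S ⊆ PanelAR1.fullParam K →
      ∃ p : ℝ, 0 < p ∧
        Tendsto (fun N : ℕ =>
          P.real {ω | PanelAR1.jointMaxima S (fun i => y i ω) (fun i => X i ω) N
            ∩ PanelAR1.restrParam K = ∅})
          atTop (𝓝 p)) ∧
    (∀ S : Set (PanelAR1.Param K), IsOpen S → S ⊆ PanelAR1.fullParam K →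
      ∀ θhat : ℕ → Ω → PanelAR1.Param K, PanelAR1.IsLancaster S y X θhat →
        ¬ TendstoInMeasure P θhat atTop (fun _ => (ρ, σ2, (1 - ρ) • βc))) := by
  subst hρ
  have hT := hM.two_le
  obtain ⟨v, hv, hlim⟩ := hM.exists_tendsto_scoreAvg h_four h_nondeg
  have hopen : ∀ x, _ := fun x => hlim (Set.Ioi x) x measurableSet_Ioi (by rw [frontier_Ioi])
  have hclosed : ∀ x, _ := fun x => hlim (Set.Ici x) x measurableSet_Ici (by rw [frontier_Ici])
  have hp : 0 < (gaussianReal 0 v (Set.Ioi 0)).toReal :=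
    ENNReal.toReal_pos (PanelAR1.gaussianReal_Ioi_pos hv 0).ne' (measure_ne_top _ _)
  refine ⟨⟨_, hp, ?_⟩, fun S hS hsub _ => ⟨_, hp, ?_⟩, fun S hS _ θhat hθ hconv => ?_⟩
  · refine (ENNReal.tendsto_toReal (measure_ne_top _ _)).comp
      (PanelAR1.tendsto_measure_of_sandwich hv hopen hclosed (fun x hx => ?_) fun x hx => ?_)
    · refine (hM.negligible_not_splits h_four hx).mono fun N ω hω => ?_
      by_contra hcon
      simp only [Set.mem_sdiff, Set.mem_ofPred_eq, not_not, Set.mem_Ioi] at hcon hω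
      obtain ⟨A, B, C, D, h1, h2, h3, -, h5, -⟩ := hcon
      exact hω.2 (h1.profMaxima_eq_empty hT h2 h3 (h5 hω.1))
    · refine (hM.negligible_not_splits h_four (neg_pos.2 hx)).mono fun N ω hω => ?_
      by_contra hcon
      simp only [Set.mem_sdiff, Set.mem_ofPred_eq, not_not, Set.mem_Ici, not_le, neg_neg]
        at hcon hω
      obtain ⟨A, B, C, D, h1, h2, h3, h4, -, h6⟩ := hcon
      exact (h1.profMaxima_nonempty hT h2 h3 h4 (h6 hω.2)).ne_empty hω.1
  · refine (ENNReal.tendsto_toReal (measure_ne_top _ _)).comp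
      (PanelAR1.tendsto_measure_of_sandwich hv hopen hclosed (fun x hx => ?_) fun x hx => ?_)
    · refine (hM.negligible_not_splits h_four hx).mono fun N ω hω => ?_
      by_contra hcon
      simp only [Set.mem_sdiff, Set.mem_ofPred_eq, not_not, Set.mem_Ioi] at hcon hω
      obtain ⟨A, B, C, D, h1, h2, h3, -, h5, -⟩ := hcon
      refine hω.2 (Set.eq_empty_of_forall_notMem fun θ hθ => ?_)
      exact h1.not_stationary hT (h5 hω.1) hθ.2.1 hθ.2.2 hθ.1.2.1
    · refine (hM.negligible_not_splits h_four (neg_pos.2 hx)).mono fun N ω hω => ?_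
      by_contra hcon
      simp only [Set.mem_sdiff, Set.mem_ofPred_eq, not_not, Set.mem_Ici, not_le, neg_neg]
        at hcon hω
      obtain ⟨A, B, C, D, h1, h2, h3, h4, -, h6⟩ := hcon
      exact (h1.jointMaxima_nonempty hT h2 h3 h4 (h6 hω.2) hsub).ne_empty hω.1
  · have hfar : PanelAR1.Negligible P fun N =>
        {ω | 1 ≤ dist (θhat N ω) ((1, σ2, ((1 : ℝ) - 1) • βc) : PanelAR1.Param K)} :=
      tendstoInMeasure_iff_dist.1 hconv 1 one_pos
    have hneg : PanelAR1.Negligible P fun N =>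
        -- Consistency would make this event negligible, although its probability has a positive
        -- normal limit; any positive threshold would serve in place of `1`.
        {ω | √N * PanelAR1.scoreAvg N (fun i => ε i ω) ∈ Set.Ioi 1} := by
      refine ((hM.negligible_not_splits h_four one_pos).union hfar).mono fun N ω hω => ?_
      by_contra hcon
      simp only [Set.mem_union, Set.mem_ofPred_eq, not_or, not_not, Set.mem_Ioi, not_le]
        at hcon hω
      obtain ⟨⟨A, B, C, D, h1, -, -, -, h5, -⟩, hd⟩ := hcon
      have hd1 : dist (θhat N ω).1 1 < 1 := lt_of_le_of_lt (le_max_left _ _) hd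
      rw [Real.dist_eq, abs_lt] at hd1
      -- An estimate within distance `1` has `0 < r < 2`. This excludes the default value `0`, and
      -- also a stationary point, since none has `r ≥ -1` here.
      rcases Set.eq_empty_or_nonempty
        (PanelAR1.jointMaxima S (fun i => y i ω) (fun i => X i ω) N) with he | hne
      · have h0 := (hθ N ω).2 he
        rw [h0] at hd1
        simp at hd1
      · have hmem := (hθ N ω).1 hne
        exact h1.not_stationary hT (h5 hω) (by linarith [hd1.1]) (‹S ⊆ _› hmem.1) hmem.2.1
    have h0 := tendsto_nhds_unique (hopen 1) hneg
    exact (PanelAR1.gaussianReal_Ioi_pos hv 1).ne' h0
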